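/- Let $B=(B_t)_{t\ge 0}$ be a standard one-dimensional Brownian motion (started at $0$, with almost surely continuous paths) on a probability space, and let $T_1=\inf\{t\ge 0: B_t=1\}$, which is almost surely finite and positive. For $x\in\mathbb R$ write $x^+=\max(x,0)$ and $x^-=\max(-x,0)$, and for $m\ge 0$ set $$A_{\pm}^{(m)}=\frac{1}{T_1^{1+m/2}}\int_0^{T_1}(B_s^{\pm})^m\,ds,\qquad A_1^{(m)}=\frac{1}{T_1^{1+m/2}}\int_0^{T_1}|B_s|^m\,\mathrm{sgn}(B_s)\,ds,$$ with the convention $0^0=0$ and $\mathrm{sgn}(0)=0$. For $m\ge 0$ let $$c_m=\mathbb E\big[|N|^m\big]=\frac{\Gamma(1+m)}{2^{m/2}\Gamma(1+m/2)}=\frac{1}{\sqrt\pi}\,2^{m/2}\,\Gamma\Big(\frac{1+m}{2}\Big),$$ where $N$ is a standard Gaussian variable, and for $m>-2$ let $$\phi(m)=\int_0^2\frac{y^{m+1}}{1+y}\,dy .$$ Then for every real $m\ge 0$ the variables $A_+^{(m)}$, $A_-^{(m)}$ and $A_1^{(m)}$ are integrable, and $$I_+^{(m)}:=\mathbb E[A_+^{(m)}]=\frac{c_m}{2^{m+1}}\,\phi(m),\qquad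 I_-^{(m)}:=\mathbb E[A_-^{(m)}]=\frac{c_m}{2^{m+1}}\log 3,\qquad \mathbb E[A_1^{(m)}]=I_+^{(m)}-I_-^{(m)}.$$ Moreover, $\phi$ is convex on $(-2,\infty)$, it is differentiable at $0$ with $\phi'(0)=\int_0^2\frac{y\log y}{1+y}\,dy>0$, and it is strictly increasing on $[0,\infty)$. Finally, $\mathbb E[A_1^{(m)}]>0$ for $m>1$, $\mathbb E[A_1^{(m)}]<0$ for $0\le m<1$, and $\mathbb E[A_1^{(1)}]=0$. -/

import Mathlib

open MeasureTheory ProbabilityTheory Set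
open scoped NNReal

namespace BrownianHit

noncomputable section

/-- The power `x ^ m` with the convention `0 ^ 0 = 0`; used for `x ≥ 0` and `m ≥ 0`. -/
def pow₀ (x m : ℝ) : ℝ := if x = 0 then 0 else x ^ m

variable {Ω : Type*}

/-- The first time at which the path of `ω` hits the level `1` (`⊤` if it never does). -/
def hit (B : ℝ≥0 → Ω → ℝ) (ω : Ω) : WithTop ℝ≥0 := hittingAfter B {1} 0 ω

/-- The first hitting time `T₁` of the level `1` as a real number. The value on the null event
where the level is never hit is irrelevant. -/
def T₁ (B : ℝ≥0 → Ω → ℝ) (ω : Ω) : ℝ := ((hit B ω).untopD 0 : ℝ≥0)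

/-- `T₁ ^ (-(1 + m/2)) * ∫₀^{T₁} (B_s⁺) ^ m ds`, with `0 ^ 0 = 0`. -/
def Apos (B : ℝ≥0 → Ω → ℝ) (m : ℝ) (ω : Ω) : ℝ :=
  1 / T₁ B ω ^ (1 + m / 2) * ∫ s in (0 : ℝ)..T₁ B ω, pow₀ (max (B s.toNNReal ω) 0) m

/-- `T₁ ^ (-(1 + m/2)) * ∫₀^{T₁} (B_s⁻) ^ m ds`, with `0 ^ 0 = 0`. -/
def Aneg (B : ℝ≥0 → Ω → ℝ) (m : ℝ) (ω : Ω) : ℝ :=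
  1 / T₁ B ω ^ (1 + m / 2) * ∫ s in (0 : ℝ)..T₁ B ω, pow₀ (max (-B s.toNNReal ω) 0) m

/-- `T₁ ^ (-(1 + m/2)) * ∫₀^{T₁} |B_s| ^ m sgn(B_s) ds`. -/
def A (B : ℝ≥0 → Ω → ℝ) (m : ℝ) (ω : Ω) : ℝ :=
  1 / T₁ B ω ^ (1 + m / 2) *
    ∫ s in (0 : ℝ)..T₁ B ω, |B s.toNNReal ω| ^ m * Real.sign (B s.toNNReal ω)

/-- The absolute moment `c_m = 𝔼[|N| ^ m]` of a standard Gaussian variable `N`. -/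
def c (m : ℝ) : ℝ := ∫ x, |x| ^ m ∂(gaussianReal 0 1)

/-- `φ(m) = ∫₀² y ^ (m+1) / (1+y) dy`. -/
def phi (m : ℝ) : ℝ := ∫ y in (0 : ℝ)..2, y ^ (m + 1) / (1 + y)

end

end BrownianHit

/-! The negative power of `T₁` is a superposition of exponentials: `∫₀^∞ θ^(m+1) exp(-θ²T/2) dθ`
equals `2^(m/2) Γ(1+m/2) T^(-(1+m/2))`. It therefore suffices to know, for each `θ > 0`, the
expectation of `exp(-θ²T₁/2) ∫₀^{T₁} f(B_s) ds`. At a fixed time `s < T₁`, the position has the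
density of Brownian motion killed at `1`, and the remaining time to reach `1` from `x` has Laplace
transform `exp(-θ(1-x))`. Integrating over `s` gives the Green function, so the expectation is
`∫_{x<1} f(x) θ⁻¹ (exp(-θ|x|) - exp(-θ(2-x))) exp(-θ(1-x)) dx` (`lintegral_discounted_functional`).
Integrating against `θ^(m+1)` leaves the weight `Γ(m+1) ((|x|+1-x)^(-(m+1)) - (3-2x)^(-(m+1)))`
(`lintegral_scaled_functional`).

For `f(x) = (x⁺)^m` a Möbius substitution turns this into `φ(m)` (`lintegral_pos_part`). For `f(x) =
(x⁻)^m` it is a Frullani-type integral equal to a multiple of `log 3` (`lintegral_neg_part`). All of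
this is done with nonnegative integrals, so that Tonelli applies freely and integrability comes out
at the end.

Both probabilistic inputs rest on the reflection principle `map_reflect`. Only independence of an
increment from the past of a deterministic time is used: the path is reflected at the first grid
time after the hit, and the mesh tends to `0`.

The sign statements hold because `φ(1) = log 3` and `φ` is strictly increasing on `[0, ∞)`, being
convex with `φ'(0) > 0`. -/

namespace BrownianHit

open Filter Topology
open scoped ENNReal

/-! ### Hitting events and the weak Markov property. -/

section

variable {Ω : Type*}

/-- The event that the path has reached the level `1` by time `t`. -/
def reached (B : ℝ≥0 → Ω → ℝ) (t : ℝ≥0) : Set Ω := {ω | ∃ r ≤ t, 1 ≤ B r ω}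

lemma reached_mono (B : ℝ≥0 → Ω → ℝ) : Monotone (reached B) :=
  fun _ _ hst _ ⟨r, hr, h⟩ ↦ ⟨r, hr.trans hst, h⟩

/-- A continuous path attains its maximum on `[0, t]`, so it reaches `1` iff it exceeds every `1 -
1/(n+1)` somewhere on a countable dense set of times. The preimage form exhibits the event as a
function of the path up to `t`, which is what independence from later increments requires. -/
lemma exists_measurableSet_reached (B : ℝ≥0 → Ω → ℝ) (hc : ∀ ω, Continuous (B · ω)) (t : ℝ≥0) :
    ∃ S : Set (Iic t → ℝ), MeasurableSet S ∧
      reached B t = (fun ω (r : Iic t) ↦ B r ω) ⁻¹' S := by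
  refine ⟨⋂ n : ℕ, ⋃ k : ℕ,
    {p | 1 - 1 / ((n : ℝ) + 1) < p (TopologicalSpace.denseSeq (Iic t) k)}, ?_, ?_⟩
  · refine MeasurableSet.iInter fun n ↦ MeasurableSet.iUnion fun k ↦ ?_
    exact measurableSet_lt measurable_const (measurable_pi_apply _)
  ext ω
  have hcont : Continuous fun r : Iic t ↦ B r ω := (hc ω).comp continuous_subtype_val
  simp only [mem_preimage, mem_iInter, mem_iUnion, mem_ofPred_eq, reached]
  constructor
  · rintro ⟨r, hr, h⟩ n
    have hpos : 0 < 1 / ((n : ℝ) + 1) := by positivity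
    exact (TopologicalSpace.denseRange_denseSeq (Iic t)).exists_mem_open
      (s := {r : Iic t | 1 - 1 / ((n : ℝ) + 1) < B r ω}) (isOpen_lt continuous_const hcont)
      ⟨⟨r, hr⟩, by simp only [mem_ofPred_eq]; linarith⟩
  · intro h
    obtain ⟨r, hr, hmax⟩ := (isCompact_Icc (a := (0 : ℝ≥0)) (b := t)).exists_isMaxOn
      ⟨0, by simp⟩ (hc ω).continuousOn
    refine ⟨r, hr.2, ?_⟩
    have hlim : Tendsto (fun n : ℕ ↦ 1 - 1 / ((n : ℝ) + 1)) atTop (𝓝 1) := by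
      simpa using (tendsto_one_div_add_atTop_nhds_zero_nat (𝕜 := ℝ)).const_sub 1
    refine le_of_tendsto' hlim fun n ↦ ?_
    obtain ⟨k, hk⟩ := h n
    exact hk.le.trans (hmax ⟨zero_le, (TopologicalSpace.denseSeq (Iic t) k).2⟩)

lemma measurableSet_reached [MeasurableSpace Ω] {B : ℝ≥0 → Ω → ℝ}
    (hc : ∀ ω, Continuous (B · ω)) (hm : ∀ t, Measurable (B t)) (t : ℝ≥0) :
    MeasurableSet (reached B t) := by
  obtain ⟨S, hS, h⟩ := exists_measurableSet_reached B hc t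
  rw [h]
  exact (measurable_pi_lambda _ fun r : Iic t ↦ hm r) hS

/-- A continuous path started at `0` that reaches the level `1` has a first hitting time. -/
lemma exists_first_hit {B : ℝ≥0 → Ω → ℝ} {ω : Ω} (hc : Continuous (B · ω)) (h0 : B 0 ω = 0)
    {u : ℝ≥0} (h : ω ∈ reached B u) :
    ∃ T : ℝ≥0, B T ω = 1 ∧ 0 < T ∧ (∀ r, ω ∈ reached B r ↔ T ≤ r) ∧ hit B ω = T := by
  obtain ⟨r₀, -, hr₀⟩ := h
  have hivt : ∀ r, 1 ≤ B r ω → ∃ s ≤ r, B s ω = 1 := fun r hr ↦ by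
    obtain ⟨s, hs, hs1⟩ := intermediate_value_Icc zero_le hc.continuousOn
      (show (1 : ℝ) ∈ Icc (B 0 ω) (B r ω) from ⟨by rw [h0]; exact zero_le_one, hr⟩)
    exact ⟨s, hs.2, hs1⟩
  let Z : Set ℝ≥0 := {i : ℝ≥0 | 0 ≤ i ∧ B i ω ∈ ({1} : Set ℝ)}
  have hne : Z.Nonempty := by
    obtain ⟨s, -, hs⟩ := hivt r₀ hr₀
    exact ⟨s, zero_le, hs⟩
  have hclosed : IsClosed Z := by
    have : Z = (B · ω) ⁻¹' {1} := by ext; simp [Z]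
    rw [this]; exact isClosed_singleton.preimage hc
  have hT : B (sInf Z) ω = 1 :=
    (hclosed.csInf_mem hne (OrderBot.bddBelow _)).2
  refine ⟨_, hT, ?_, fun r ↦ ⟨fun ⟨s, hs, hs1⟩ ↦ ?_, fun hr ↦ ⟨_, hr, hT.ge⟩⟩, ?_⟩
  · refine pos_iff_ne_zero.2 fun h ↦ ?_
    rw [h, h0] at hT
    exact zero_ne_one hT
  · obtain ⟨q, hq, hq1⟩ := hivt s hs1
    have hTq : sInf Z ≤ q := csInf_le (OrderBot.bddBelow _) ⟨zero_le, hq1⟩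
    exact hTq.trans (hq.trans hs)
  · obtain ⟨s, hs⟩ := hne
    rw [hit, hittingAfter, if_pos ⟨s, hs⟩]

variable [MeasurableSpace Ω] {P : Measure Ω} {B : ℝ≥0 → Ω → ℝ}

/-- The **weak Markov property**: an increment is independent of the path before it. -/
lemma indepFun_increment_past (hB : IsPreBrownianReal B P) {t u : ℝ≥0} (htu : t ≤ u) :
    IndepFun (fun ω ↦ B u ω - B t ω) (fun ω (r : Iic t) ↦ B r ω) P := by
  have hφ : Measurable fun p : ℝ≥0 → ℝ ↦ p (u - t) := measurable_pi_apply (u - t)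
  have := (hB.indepFun_shift t).comp hφ measurable_id
  convert this using 2 with ω
  · simp [add_tsub_cancel_of_le htu]
  · rfl

lemma map_increment (hB : IsPreBrownianReal B P) {t u : ℝ≥0} (htu : t ≤ u) :
    P.map (fun ω ↦ B u ω - B t ω) = gaussianReal 0 (u - t) := by
  have := ((hB.shift t).hasLaw_eval (u - t)).map_eq
  rwa [add_tsub_cancel_of_le htu] at this

/-- Reflecting the increment after time `t` does not change integrals over events of the past. -/
lemma lintegral_past_reflect (hB : IsPreBrownianReal B P) (hm : ∀ t, Measurable (B t))
    {s t u : ℝ≥0} (hst : s ≤ t) (htu : t ≤ u) {S : Set (Iic t → ℝ)} (hS : MeasurableSet S)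
    {G : ℝ × ℝ → ℝ≥0∞} (hG : Measurable G) :
    ∫⁻ ω in (fun ω (r : Iic t) ↦ B r ω) ⁻¹' S, G (B s ω, B u ω) ∂P =
      ∫⁻ ω in (fun ω (r : Iic t) ↦ B r ω) ⁻¹' S, G (B s ω, 2 * B t ω - B u ω) ∂P := by
  have := hB.isGaussianProcess.isProbabilityMeasure
  have hY : Measurable fun ω (r : Iic t) ↦ B r ω := measurable_pi_lambda _ fun r ↦ hm r
  have hW : Measurable fun ω ↦ B u ω - B t ω := (hm u).sub (hm t)
  have hW' : Measurable fun ω ↦ -(B u ω - B t ω) := hW.neg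
  have hind := indepFun_increment_past hB htu
  have hind' : IndepFun (fun ω ↦ -(B u ω - B t ω)) (fun ω (r : Iic t) ↦ B r ω) P :=
    hind.comp (φ := fun x : ℝ ↦ -x) (ψ := id) measurable_neg measurable_id
  have hlaw : P.map (fun ω ↦ -(B u ω - B t ω)) = P.map (fun ω ↦ B u ω - B t ω) := by
    have : (fun ω ↦ -(B u ω - B t ω)) = (fun x ↦ -x) ∘ (fun ω ↦ B u ω - B t ω) := rfl
    rw [this, ← Measure.map_map measurable_neg hW, map_increment hB htu, gaussianReal_map_neg, neg_zero]
  -- The increment is symmetric and independent of the past, so flipping its sign preserves its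
  -- joint law with the past.
  have hmap : P.map (fun ω ↦ (B u ω - B t ω, fun r : Iic t ↦ B r ω)) =
      P.map (fun ω ↦ (-(B u ω - B t ω), fun r : Iic t ↦ B r ω)) := by
    rw [(indepFun_iff_map_prod_eq_prod_map_map hW.aemeasurable hY.aemeasurable).1 hind,
      (indepFun_iff_map_prod_eq_prod_map_map hW'.aemeasurable hY.aemeasurable).1 hind', hlaw]
  have hΦ : Measurable fun q : ℝ × (Iic t → ℝ) ↦
      (Prod.snd ⁻¹' S).indicator (fun q ↦ G (q.2 ⟨s, hst⟩, q.2 ⟨t, self_mem_Iic⟩ + q.1)) q := by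
    refine Measurable.indicator ?_ (measurable_snd hS)
    fun_prop
  have key : ∀ W : Ω → ℝ, Measurable W →
      ∫⁻ ω in (fun ω (r : Iic t) ↦ B r ω) ⁻¹' S, G (B s ω, B t ω + W ω) ∂P =
      ∫⁻ q, (Prod.snd ⁻¹' S).indicator (fun q ↦ G (q.2 ⟨s, hst⟩, q.2 ⟨t, self_mem_Iic⟩ + q.1)) q
        ∂(P.map fun ω ↦ (W ω, fun r : Iic t ↦ B r ω)) := fun W hW ↦ by
    rw [lintegral_map hΦ (hW.prodMk hY), ← lintegral_indicator (hY hS)]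
    rfl
  have e1 := key _ hW
  have e2 := key _ hW'
  rw [hmap] at e1
  have e : ∀ ω, B t ω + (B u ω - B t ω) = B u ω := fun ω ↦ by ring
  have e' : ∀ ω, B t ω + -(B u ω - B t ω) = 2 * B t ω - B u ω := fun ω ↦ by ring
  simp only [e] at e1
  simp only [e'] at e2
  exact e1.trans e2.symm

end

/-! ### The reflection principle by discretisation of the hitting time. -/

section

variable {Ω : Type*} {B : ℝ≥0 → Ω → ℝ}

/-- The `k`-th point of the partition of `[s, u]` into `n + 1` equal parts. -/
noncomputable def gridPoint (s u : ℝ≥0) (n k : ℕ) : ℝ≥0 := s + k * ((u - s) / (n + 1))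

lemma gridPoint_zero (s u : ℝ≥0) (n : ℕ) : gridPoint s u n 0 = s := by simp [gridPoint]

lemma gridPoint_last {s u : ℝ≥0} (hsu : s ≤ u) (n : ℕ) : gridPoint s u n (n + 1) = u := by
  rw [gridPoint, Nat.cast_add_one, mul_div_cancel₀ _ (by positivity), add_tsub_cancel_of_le hsu]

lemma gridPoint_mono (s u : ℝ≥0) (n : ℕ) : Monotone (gridPoint s u n) := fun k l hkl ↦ by
  unfold gridPoint; gcongr

lemma gridPoint_succ (s u : ℝ≥0) (n k : ℕ) :
    gridPoint s u n (k + 1) = gridPoint s u n k + (u - s) / (n + 1) := by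
  simp only [gridPoint, Nat.cast_add_one]; ring

/-- The event that the level `1` is first reached in the `k`-th cell of the partition. -/
def reachedIn (B : ℝ≥0 → Ω → ℝ) (s u : ℝ≥0) (n k : ℕ) : Set Ω :=
  reached B (gridPoint s u n (k + 1)) \ reached B (gridPoint s u n k)

lemma pairwise_disjoint_reachedIn (B : ℝ≥0 → Ω → ℝ) (s u : ℝ≥0) (n : ℕ) :
    Pairwise (Function.onFun Disjoint (reachedIn B s u n)) := by
  have key : ∀ k l, k < l → Disjoint (reachedIn B s u n k) (reachedIn B s u n l) :=
    fun k l hkl ↦ Set.disjoint_left.2 fun ω hk hl ↦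
      hl.2 (reached_mono B (gridPoint_mono s u n hkl) hk.1)
  intro k l hkl
  rcases hkl.lt_or_gt with h | h
  · exact key k l h
  · exact (key l k h).symm

lemma iUnion_reachedIn (B : ℝ≥0 → Ω → ℝ) {s u : ℝ≥0} (hsu : s ≤ u) (n : ℕ) :
    ⋃ k ∈ Finset.range (n + 1), reachedIn B s u n k = reached B u \ reached B s := by
  classical
  ext ω
  simp only [mem_iUnion, Finset.mem_range, exists_prop]
  constructor
  · rintro ⟨k, hk, h1, h2⟩
    refine ⟨reached_mono B ((gridPoint_mono s u n hk).trans_eq (gridPoint_last hsu n)) h1,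
      fun h ↦ h2 (reached_mono B ?_ h)⟩
    exact (gridPoint_zero s u n).symm.le.trans (gridPoint_mono s u n k.zero_le)
  · rintro ⟨h1, h2⟩
    have hex : ∃ k, ω ∈ reached B (gridPoint s u n k) :=
      ⟨n + 1, by rwa [gridPoint_last hsu]⟩
    have hpos : Nat.find hex ≠ 0 := fun h ↦ by
      have := Nat.find_spec hex
      rw [h, gridPoint_zero] at this
      exact h2 this
    obtain ⟨k, hk⟩ := Nat.exists_eq_succ_of_ne_zero hpos
    refine ⟨k, ?_, ?_, Nat.find_min hex (by omega)⟩
    · have := Nat.find_min' hex (m := n + 1) (by rwa [gridPoint_last hsu])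
      omega
    · have := Nat.find_spec hex
      rwa [hk] at this

/-- The value of the path at the right end of the cell in which the level `1` is reached. -/
noncomputable def cellValue (B : ℝ≥0 → Ω → ℝ) (s u : ℝ≥0) (n : ℕ) (ω : Ω) : ℝ :=
  ∑ k ∈ Finset.range (n + 1),
    (reachedIn B s u n k).indicator (B (gridPoint s u n (k + 1))) ω

lemma cellValue_eq {s u : ℝ≥0} {n k : ℕ} {ω : Ω} (hk : k < n + 1)
    (h : ω ∈ reachedIn B s u n k) :
    cellValue B s u n ω = B (gridPoint s u n (k + 1)) ω := by
  rw [cellValue, Finset.sum_eq_single_of_mem k (Finset.mem_range.2 hk), indicator_of_mem h]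
  intro l _ hlk
  exact indicator_of_notMem
    (fun hl ↦ Set.disjoint_left.1 (pairwise_disjoint_reachedIn B s u n hlk) hl h) _

/-- The right end of the cell containing the hitting time `T` lies between `T` and `T` plus the
mesh, and the path is continuous with value `1` at `T`. -/
lemma tendsto_cellValue {s u : ℝ≥0} (hsu : s ≤ u) {ω : Ω} (hc : Continuous (B · ω))
    (h0 : B 0 ω = 0) (h : ω ∈ reached B u \ reached B s) :
    Tendsto (fun n ↦ cellValue B s u n ω) atTop (𝓝 1) := by
  obtain ⟨T, hT1, -, hT, -⟩ := exists_first_hit hc h0 h.1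
  have hex : ∀ n, ∃ r, cellValue B s u n ω = B r ω ∧ T ≤ r ∧ r ≤ T + (u - s) / (n + 1) := by
    intro n
    have hmem := h
    rw [← iUnion_reachedIn B hsu n] at hmem
    simp only [mem_iUnion, Finset.mem_range, exists_prop] at hmem
    obtain ⟨k, hk, hω⟩ := hmem
    refine ⟨_, cellValue_eq hk hω, (hT _).1 hω.1, ?_⟩
    rw [gridPoint_succ]
    gcongr
    exact (not_le.1 fun h ↦ hω.2 ((hT _).2 h)).le
  choose r hr using hex
  simp only [fun n ↦ (hr n).1]
  rw [← hT1]
  refine (hc.tendsto T).comp (tendsto_of_tendsto_of_tendsto_of_le_of_le tendsto_const_nhds ?_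
    (fun n ↦ (hr n).2.1) fun n ↦ (hr n).2.2)
  have : Tendsto (fun n : ℕ ↦ (u - s) / ((n : ℝ≥0) + 1)) atTop (𝓝 0) := by
    have h1 := (tendsto_one_div_add_atTop_nhds_zero_nat (𝕜 := ℝ≥0)).const_mul (u - s)
    simpa [div_eq_mul_inv] using h1
  simpa using this.const_add T

variable [MeasurableSpace Ω] {P : Measure Ω}

lemma measurableSet_reachedIn (hc : ∀ ω, Continuous (B · ω)) (hm : ∀ t, Measurable (B t))
    (s u : ℝ≥0) (n k : ℕ) : MeasurableSet (reachedIn B s u n k) :=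
  (measurableSet_reached hc hm _).diff (measurableSet_reached hc hm _)

lemma measurable_cellValue (hc : ∀ ω, Continuous (B · ω)) (hm : ∀ t, Measurable (B t))
    (s u : ℝ≥0) (n : ℕ) : Measurable (cellValue B s u n) :=
  Finset.measurable_fun_sum _ fun _ _ ↦ (hm _).indicator (measurableSet_reachedIn hc hm s u n _)

/-- Whether the first hit falls in a given cell is decided by the path up to the right end of that
cell. Reflection at this deterministic time is thus legitimate on each cell, and the cells are
summed; this stands in for the strong Markov property. -/
lemma lintegral_reflect_cellValue (hB : IsPreBrownianReal B P) (hm : ∀ t, Measurable (B t))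
    (hc : ∀ ω, Continuous (B · ω)) {s u : ℝ≥0} (hsu : s ≤ u) {G : ℝ × ℝ → ℝ≥0∞}
    (hG : Measurable G) (n : ℕ) :
    ∫⁻ ω in reached B u \ reached B s, G (B s ω, B u ω) ∂P =
      ∫⁻ ω in reached B u \ reached B s, G (B s ω, 2 * cellValue B s u n ω - B u ω) ∂P := by
  rw [← iUnion_reachedIn B hsu n,
    lintegral_biUnion_finset ((pairwise_disjoint_reachedIn B s u n).set_pairwise _)
      fun k _ ↦ measurableSet_reachedIn hc hm s u n k,
    lintegral_biUnion_finset ((pairwise_disjoint_reachedIn B s u n).set_pairwise _)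
      fun k _ ↦ measurableSet_reachedIn hc hm s u n k]
  refine Finset.sum_congr rfl fun k hk ↦ ?_
  have hk' : k < n + 1 := Finset.mem_range.1 hk
  have hst : s ≤ gridPoint s u n (k + 1) :=
    (gridPoint_zero s u n).symm.le.trans (gridPoint_mono s u n (k + 1).zero_le)
  have htu : gridPoint s u n (k + 1) ≤ u :=
    (gridPoint_mono s u n hk').trans_eq (gridPoint_last hsu n)
  have hpast : ∃ S : Set (Iic (gridPoint s u n (k + 1)) → ℝ), MeasurableSet S ∧
      reachedIn B s u n k = (fun ω (r : Iic (gridPoint s u n (k + 1))) ↦ B r ω) ⁻¹' S := by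
    obtain ⟨S₁, hS₁, h₁⟩ := exists_measurableSet_reached B hc (gridPoint s u n (k + 1))
    obtain ⟨S₂, hS₂, h₂⟩ := exists_measurableSet_reached B hc (gridPoint s u n k)
    have hle : gridPoint s u n k ≤ gridPoint s u n (k + 1) := gridPoint_mono s u n k.le_succ
    let ρ : (Iic (gridPoint s u n (k + 1)) → ℝ) → (Iic (gridPoint s u n k) → ℝ) :=
      fun p r ↦ p ⟨r.1, mem_Iic.2 ((mem_Iic.1 r.2).trans hle)⟩
    have hρ : Measurable ρ := measurable_pi_lambda _ fun r ↦ measurable_pi_apply _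
    refine ⟨S₁ \ ρ ⁻¹' S₂, hS₁.diff (hρ hS₂), ?_⟩
    rw [reachedIn, h₁, h₂]
    rfl
  obtain ⟨S, hS, hES⟩ := hpast
  have h1 := lintegral_past_reflect hB hm hst htu hS hG
  rw [← hES] at h1
  rw [h1]
  refine setLIntegral_congr_fun (measurableSet_reachedIn hc hm s u n k) fun ω hω ↦ ?_
  simp only [cellValue_eq hk' hω]

/-- The **reflection principle**: on the event that the level `1` is first reached in `(s, u]`,
the joint law of `(B s, B u)` is unchanged when `B u` is reflected at the level `1`. -/
lemma map_reflect (hB : IsPreBrownianReal B P) (hm : ∀ t, Measurable (B t))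
    (hc : ∀ ω, Continuous (B · ω)) (h0 : ∀ ω, B 0 ω = 0) {s u : ℝ≥0} (hsu : s ≤ u) :
    (P.restrict (reached B u \ reached B s)).map (fun ω ↦ (B s ω, B u ω)) =
      (P.restrict (reached B u \ reached B s)).map (fun ω ↦ (B s ω, 2 - B u ω)) := by
  have := hB.isGaussianProcess.isProbabilityMeasure
  have hm1 : Measurable fun ω ↦ (B s ω, B u ω) := (hm s).prodMk (hm u)
  have hm2 : Measurable fun ω ↦ (B s ω, 2 - B u ω) := (hm s).prodMk (measurable_const.sub (hm u))
  -- Bounded continuous test functions suffice to identify finite measures, and continuity lets the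
  -- cell value be replaced by its limit `1`.
  refine ext_of_forall_lintegral_eq_of_IsFiniteMeasure fun f ↦ ?_
  have hf : Measurable fun x ↦ (f x : ℝ≥0∞) := f.continuous.measurable.coe_nnreal_ennreal
  rw [lintegral_map hf hm1, lintegral_map hf hm2]
  have hlim : Tendsto (fun n ↦ ∫⁻ ω in reached B u \ reached B s,
      (f (B s ω, 2 * cellValue B s u n ω - B u ω) : ℝ≥0∞) ∂P) atTop
      (𝓝 (∫⁻ ω in reached B u \ reached B s, (f (B s ω, 2 - B u ω) : ℝ≥0∞) ∂P)) := by
    refine tendsto_lintegral_of_dominated_convergence (fun _ ↦ ((nndist 0 f : ℝ≥0) : ℝ≥0∞))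
      (fun n ↦ ?_) (fun n ↦ ?_) ?_ ?_
    · exact hf.comp ((hm s).prodMk (((measurable_cellValue hc hm s u n).const_mul 2).sub (hm u)))
    · refine ae_of_all _ fun ω ↦ ?_
      exact ENNReal.coe_le_coe.2 (f.apply_le_nndist_zero _)
    · simp [ENNReal.mul_eq_top]
    · refine (ae_restrict_iff' ((measurableSet_reached hc hm u).diff
        (measurableSet_reached hc hm s))).2 (ae_of_all _ fun ω hω ↦ ?_)
      have h1 := tendsto_cellValue hsu (hc ω) (h0 ω) hω
      have h2 : Tendsto (fun n ↦ (B s ω, 2 * cellValue B s u n ω - B u ω)) atTop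
          (𝓝 (B s ω, 2 - B u ω)) := by
        refine tendsto_const_nhds.prodMk_nhds ?_
        simpa using (h1.const_mul 2).sub_const (B u ω)
      exact ENNReal.tendsto_coe.2 ((f.continuous.tendsto _).comp h2)
  simp only [← lintegral_reflect_cellValue hB hm hc hsu hf] at hlim
  exact tendsto_nhds_unique tendsto_const_nhds hlim

end

/-! ### Killed heat kernel, law of the hitting time, almost sure finiteness. -/

section

/-- The density at `x` of the centered Gaussian law of variance `s`. -/
noncomputable def heat (s x : ℝ) : ℝ := (√(2 * Real.pi * s))⁻¹ * Real.exp (-x ^ 2 / (2 * s))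

/-- The density at time `s` of a Brownian motion killed at the level `1`. -/
noncomputable def killedHeat (s x : ℝ) : ℝ := heat s x - heat s (2 - x)

lemma heat_nonneg (s x : ℝ) : 0 ≤ heat s x := by unfold heat; positivity

lemma killedHeat_nonneg {s x : ℝ} (hs : 0 ≤ s) (hx : x ≤ 1) : 0 ≤ killedHeat s x := by
  rw [killedHeat, sub_nonneg, heat, heat]
  refine mul_le_mul_of_nonneg_left (Real.exp_le_exp.2 ?_) (by positivity)
  exact div_le_div_of_nonneg_right (by nlinarith) (by positivity)

lemma gaussianReal_apply_eq_heat {v : ℝ≥0} (hv : v ≠ 0) (s : Set ℝ) :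
    gaussianReal 0 v s = ∫⁻ x in s, ENNReal.ofReal (heat v x) := by
  rw [gaussianReal_apply _ hv]
  simp [gaussianPDF, gaussianPDFReal, heat]

lemma gaussianReal_two_apply_eq_heat {v : ℝ≥0} (hv : v ≠ 0) (s : Set ℝ) :
    gaussianReal 2 v s = ∫⁻ x in s, ENNReal.ofReal (heat v (2 - x)) := by
  rw [gaussianReal_apply _ hv]
  have : ∀ x : ℝ, (x - 2) ^ 2 = (2 - x) ^ 2 := fun x ↦ by ring
  simp [gaussianPDF, gaussianPDFReal, heat, this]

lemma gaussianReal_Iio_neg (v : ℝ≥0) (a : ℝ) :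
    gaussianReal 0 v (Iio (-a)) = gaussianReal 0 v (Ioi a) := by
  have h := gaussianReal_map_neg (μ := 0) (v := v)
  rw [neg_zero] at h
  calc gaussianReal 0 v (Iio (-a)) = (gaussianReal 0 v).map (fun x ↦ -x) (Iio (-a)) := by rw [h]
    _ = gaussianReal 0 v (Ioi a) := by
      rw [Measure.map_apply measurable_neg measurableSet_Iio]
      congr 1
      ext x
      simp

/-- The density of variance `n` is at most `(2πn)^(-1/2)`, and the interval has length `2`. -/
lemma tendsto_gaussianReal_Icc :
    Tendsto (fun n : ℕ ↦ gaussianReal 0 n (Icc (-1) 1)) atTop (𝓝 0) := by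
  have hb : ∀ᶠ n : ℕ in atTop, gaussianReal 0 n (Icc (-1) 1) ≤
      ENNReal.ofReal ((√(2 * Real.pi * n))⁻¹) * 2 := by
    filter_upwards [eventually_ne_atTop 0] with n hn
    rw [gaussianReal_apply_eq_heat (by exact_mod_cast hn)]
    calc ∫⁻ x in Icc (-1 : ℝ) 1, ENNReal.ofReal (heat (n : ℝ≥0) x)
        ≤ ∫⁻ x in Icc (-1 : ℝ) 1, ENNReal.ofReal ((√(2 * Real.pi * n))⁻¹) := by
          refine lintegral_mono fun x ↦ ENNReal.ofReal_le_ofReal ?_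
          rw [heat]
          refine mul_le_of_le_one_right (by positivity) (Real.exp_le_one_iff.2 ?_)
          rw [neg_div]
          exact neg_nonpos.2 (by positivity)
      _ = _ := by
          rw [setLIntegral_const, Real.volume_Icc]; norm_num
  have hlim : Tendsto (fun n : ℕ ↦ ENNReal.ofReal ((√(2 * Real.pi * n))⁻¹) * 2) atTop (𝓝 0) := by
    have h1 : Tendsto (fun n : ℕ ↦ (√(2 * Real.pi * n))⁻¹) atTop (𝓝 0) :=
      tendsto_inv_atTop_zero.comp (Real.tendsto_sqrt_atTop.comp
        (tendsto_natCast_atTop_atTop.const_mul_atTop (by positivity)))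
    have h2 := ENNReal.Tendsto.mul_const (b := 2) (ENNReal.tendsto_ofReal h1) (by simp)
    simpa using h2
  exact tendsto_of_tendsto_of_tendsto_of_le_of_le' tendsto_const_nhds hlim
    (Eventually.of_forall fun _ ↦ zero_le) hb

variable {Ω : Type*} {B : ℝ≥0 → Ω → ℝ}

lemma reached_zero (h0 : ∀ ω, B 0 ω = 0) : reached B 0 = ∅ := by
  ext ω
  simp only [reached, nonpos_iff_eq_zero, exists_eq_left, h0, mem_ofPred_eq, mem_empty_iff_false,
    iff_false, not_le]
  exact zero_lt_one

variable [MeasurableSpace Ω] {P : Measure Ω}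

/-- Integrals of functions of `B s` and `B u` over an event of the past of `s < u`, with the
increment integrated out. -/
lemma lintegral_past_increment (hB : IsPreBrownianReal B P) (hm : ∀ t, Measurable (B t))
    {t u : ℝ≥0} (htu : t ≤ u) {S : Set (Iic t → ℝ)} (hS : MeasurableSet S)
    {G : ℝ × ℝ → ℝ≥0∞} (hG : Measurable G) :
    ∫⁻ ω in (fun ω (r : Iic t) ↦ B r ω) ⁻¹' S, G (B t ω, B u ω) ∂P =
      ∫⁻ ω in (fun ω (r : Iic t) ↦ B r ω) ⁻¹' S,
        ∫⁻ w, G (B t ω, B t ω + w) ∂(gaussianReal 0 (u - t)) ∂P := by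
  have := hB.isGaussianProcess.isProbabilityMeasure
  have hY : Measurable fun ω (r : Iic t) ↦ B r ω := measurable_pi_lambda _ fun r ↦ hm r
  have hW : Measurable fun ω ↦ B u ω - B t ω := (hm u).sub (hm t)
  let Φ : (Iic t → ℝ) × ℝ → ℝ≥0∞ := (Prod.fst ⁻¹' S).indicator
    fun q ↦ G (q.1 ⟨t, self_mem_Iic⟩, q.1 ⟨t, self_mem_Iic⟩ + q.2)
  have hΦ : Measurable Φ := by
    refine Measurable.indicator ?_ (measurable_fst hS)
    fun_prop
  have hprod := (indepFun_iff_map_prod_eq_prod_map_map hY.aemeasurable hW.aemeasurable).1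
    (indepFun_increment_past hB htu).symm
  rw [map_increment hB htu] at hprod
  calc ∫⁻ ω in (fun ω (r : Iic t) ↦ B r ω) ⁻¹' S, G (B t ω, B u ω) ∂P
      = ∫⁻ ω, Φ ((fun r : Iic t ↦ B r ω), B u ω - B t ω) ∂P := by
        rw [← lintegral_indicator (hY hS)]
        refine lintegral_congr fun ω ↦ ?_
        by_cases h : (fun r : Iic t ↦ B r ω) ∈ S <;> simp [Φ, indicator, h]
    _ = ∫⁻ p, ∫⁻ w, Φ (p, w) ∂(gaussianReal 0 (u - t)) ∂(P.map fun ω (r : Iic t) ↦ B r ω) := by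
        rw [← lintegral_map (f := Φ) (g := fun ω ↦ ((fun r : Iic t ↦ B r ω), B u ω - B t ω)) hΦ
          (hY.prodMk hW), hprod, lintegral_prod _ hΦ.aemeasurable]
    _ = _ := by
        rw [lintegral_map hΦ.lintegral_prod_right' hY, ← lintegral_indicator (hY hS)]
        refine lintegral_congr fun ω ↦ ?_
        by_cases h : (fun r : Iic t ↦ B r ω) ∈ S <;> simp [Φ, indicator, h]

/-- The law of `B s` on the event that the level `1` has not been reached by time `s`. -/
lemma map_restrict_compl_reached (hB : IsPreBrownianReal B P) (hm : ∀ t, Measurable (B t))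
    (hc : ∀ ω, Continuous (B · ω)) (h0 : ∀ ω, B 0 ω = 0) {s : ℝ≥0} (hs : s ≠ 0) :
    (P.restrict (reached B s)ᶜ).map (B s) =
      (volume.restrict (Iio 1)).withDensity fun x ↦ ENNReal.ofReal (killedHeat s x) := by
  have := hB.isGaussianProcess.isProbabilityMeasure
  have hR := measurableSet_reached hc hm s
  have hlaw : P.map (B s) = gaussianReal 0 s := (hB.hasLaw_eval s).map_eq
  ext A hA
  have hA1 : MeasurableSet (A ∩ Iio 1) := hA.inter measurableSet_Iio
  have hm2 : Measurable fun ω ↦ 2 - B s ω := measurable_const.sub (hm s)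
  -- A path that has not reached `1` is below `1` at time `s`, so the restriction to `Iio 1` is
  -- automatic on the complement.
  have e1 : P (B s ⁻¹' (A ∩ Iio 1)) = P ((reached B s)ᶜ ∩ B s ⁻¹' A) +
      P (reached B s ∩ B s ⁻¹' (A ∩ Iio 1)) := by
    rw [← measure_inter_add_sdiff (B s ⁻¹' (A ∩ Iio 1)) hR, add_comm, inter_comm (reached B s)]
    congr 2
    ext ω
    simp only [Set.mem_sdiff, mem_preimage, mem_inter_iff, mem_Iio, mem_compl_iff]
    refine ⟨fun h ↦ ⟨h.2, h.1.1⟩, fun h ↦ ⟨⟨h.2, ?_⟩, h.1⟩⟩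
    exact not_le.1 fun h' ↦ h.1 ⟨s, le_rfl, h'⟩
  -- Reflection with starting time `0`: the reflected endpoint lies below `1` only if `B s > 1`,
  -- which already forces a hit, so the hitting constraint drops out.
  have e2 : P (reached B s ∩ B s ⁻¹' (A ∩ Iio 1)) =
      gaussianReal 2 s (A ∩ Iio 1) := by
    have h := congrArg (fun μ ↦ (μ.map Prod.snd) (A ∩ Iio 1))
      (map_reflect hB hm hc h0 (zero_le (a := s)))
    rw [reached_zero h0, sdiff_empty] at h
    simp only [Measure.map_map measurable_snd ((hm 0).prodMk (hm s)),
      Measure.map_map measurable_snd ((hm 0).prodMk hm2)] at h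
    rw [Measure.map_apply (measurable_snd.comp ((hm 0).prodMk (hm s))) hA1,
      Measure.map_apply (measurable_snd.comp ((hm 0).prodMk hm2)) hA1,
      Measure.restrict_apply (((measurable_snd.comp ((hm 0).prodMk (hm s)))) hA1),
      Measure.restrict_apply (((measurable_snd.comp ((hm 0).prodMk hm2))) hA1)] at h
    have h2 : gaussianReal 2 s = P.map fun ω ↦ 2 - B s ω := by
      have := gaussianReal_map_const_sub (μ := 0) (v := s) 2
      rw [sub_zero, ← hlaw, Measure.map_map (by fun_prop) (hm s)] at this
      exact this.symm
    rw [h2, Measure.map_apply hm2 hA1, inter_comm]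
    refine h.trans (congrArg P (inter_eq_left.2 fun ω hω ↦ ⟨s, le_rfl, ?_⟩))
    have : 2 - B s ω < 1 := hω.2
    linarith
  have e3 : P (B s ⁻¹' (A ∩ Iio 1)) = (∫⁻ x in A ∩ Iio 1, ENNReal.ofReal (killedHeat s x)) +
      gaussianReal 2 s (A ∩ Iio 1) := by
    rw [← Measure.map_apply (hm s) hA1, hlaw, gaussianReal_apply_eq_heat hs,
      gaussianReal_two_apply_eq_heat hs,
      ← lintegral_add_right _ (by unfold heat; fun_prop)]
    refine setLIntegral_congr_fun hA1 fun x hx ↦ ?_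
    rw [← ENNReal.ofReal_add (killedHeat_nonneg s.coe_nonneg (mem_Iio.1 hx.2).le) (heat_nonneg _ _), killedHeat,
      sub_add_cancel]
  rw [Measure.map_apply (hm s) hA, Measure.restrict_apply (hm s hA), withDensity_apply _ hA,
    Measure.restrict_restrict hA, inter_comm]
  rw [e1, e2] at e3
  exact (ENNReal.add_left_inj (measure_ne_top _ _)).1 e3

lemma lintegral_compl_reached (hB : IsPreBrownianReal B P) (hm : ∀ t, Measurable (B t))
    (hc : ∀ ω, Continuous (B · ω)) (h0 : ∀ ω, B 0 ω = 0) {s : ℝ≥0} (hs : s ≠ 0)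
    {f : ℝ → ℝ≥0∞} (hf : Measurable f) :
    ∫⁻ ω in (reached B s)ᶜ, f (B s ω) ∂P =
      ∫⁻ x in Iio 1, ENNReal.ofReal (killedHeat s x) * f x := by
  rw [← lintegral_map hf (hm s), map_restrict_compl_reached hB hm hc h0 hs,
    lintegral_withDensity_eq_lintegral_mul _ _ hf]
  · rfl
  · unfold killedHeat heat
    fun_prop

/-- Integrals over the event that the level `1` is first reached in `(s, u]`. -/
lemma lintegral_reached_diff (hB : IsPreBrownianReal B P) (hm : ∀ t, Measurable (B t))
    (hc : ∀ ω, Continuous (B · ω)) (h0 : ∀ ω, B 0 ω = 0) {s u : ℝ≥0} (hsu : s < u)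
    {f : ℝ → ℝ≥0∞} (hf : Measurable f) :
    ∫⁻ ω in reached B u \ reached B s, f (B s ω) ∂P =
      ∫⁻ ω in (reached B s)ᶜ, f (B s ω) * (2 * gaussianReal 0 (u - s) (Ioi (1 - B s ω))) ∂P := by
  have := hB.isGaussianProcess.isProbabilityMeasure
  have hRs := measurableSet_reached hc hm s
  have hE := (measurableSet_reached hc hm u).diff hRs
  have hu : u ≠ 0 := (zero_le.trans_lt hsu).ne'
  have hm1 : Measurable fun ω ↦ (B s ω, B u ω) := (hm s).prodMk (hm u)
  have hm2 : Measurable fun ω ↦ (B s ω, 2 - B u ω) := (hm s).prodMk (measurable_const.sub (hm u))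
  have hne : ∀ᵐ ω ∂P, B u ω ≠ 1 := by
    have h1 : P.map (B u) {1} = 0 := by
      have := nullSingletonClass_gaussianReal (μ := 0) hu
      rw [(hB.hasLaw_eval u).map_eq, measure_singleton]
    rw [Measure.map_apply (hm u) (measurableSet_singleton 1)] at h1
    exact measure_eq_zero_iff_ae_notMem.1 h1
  let G : Set ℝ → ℝ × ℝ → ℝ≥0∞ := fun A q ↦ f q.1 * A.indicator 1 q.2
  have hG : ∀ A, MeasurableSet A → Measurable (G A) := fun A hA ↦
    (hf.comp measurable_fst).mul ((measurable_one.indicator hA).comp measurable_snd)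
  have hrefl : ∫⁻ ω in reached B u \ reached B s, G (Iio 1) (B s ω, B u ω) ∂P =
      ∫⁻ ω in reached B u \ reached B s, G (Ioi 1) (B s ω, B u ω) ∂P := by
    rw [← lintegral_map (hG _ measurableSet_Iio) hm1, map_reflect hB hm hc h0 hsu.le,
      lintegral_map (hG _ measurableSet_Iio) hm2]
    refine lintegral_congr fun ω ↦ ?_
    have : 2 - B u ω < 1 ↔ 1 < B u ω := by constructor <;> intro h <;> linarith
    simp only [G, indicator_apply, mem_Iio, mem_Ioi, this, Pi.one_apply]
  -- Almost surely `B u ≠ 1`, and by reflection the two sides of the level contribute equally; this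
  -- is the factor `2`.
  have hsplit : ∫⁻ ω in reached B u \ reached B s, f (B s ω) ∂P =
      2 * ∫⁻ ω in reached B u \ reached B s, G (Ioi 1) (B s ω, B u ω) ∂P := by
    rw [two_mul]
    nth_rw 1 [← hrefl]
    have hGm : Measurable fun ω ↦ G (Iio 1) (B s ω, B u ω) := (hG _ measurableSet_Iio).comp hm1
    rw [← lintegral_add_left hGm]
    refine lintegral_congr_ae ?_
    filter_upwards [ae_restrict_of_ae hne] with ω hω
    rcases hω.lt_or_gt with h | h
    · simp [G, indicator, h, h.le.not_gt]
    · simp [G, indicator, h, h.le.not_gt]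
  -- `B u > 1` already implies a hit by time `u`. The domain thus becomes an event of the past of
  -- `s`, and the increment can be integrated out.
  have hset : ∫⁻ ω in reached B u \ reached B s, G (Ioi 1) (B s ω, B u ω) ∂P =
      ∫⁻ ω in (reached B s)ᶜ, G (Ioi 1) (B s ω, B u ω) ∂P := by
    rw [← lintegral_indicator hE, ← lintegral_indicator hRs.compl]
    refine lintegral_congr fun ω ↦ ?_
    by_cases h : 1 < B u ω
    · have : ω ∈ reached B u := ⟨u, le_rfl, h.le⟩
      by_cases h' : ω ∈ reached B s <;> simp [indicator, this, h']
    · simp [indicator, G, h]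
  obtain ⟨S, hS, hRS⟩ := exists_measurableSet_reached B hc s
  have hmarkov := lintegral_past_increment hB hm hsu.le hS.compl (hG (Ioi 1) measurableSet_Ioi)
  rw [preimage_compl, ← hRS] at hmarkov
  rw [hsplit, hset, hmarkov, ← lintegral_const_mul' _ _ (by simp)]
  refine lintegral_congr fun ω ↦ ?_
  have : ∀ w, (Ioi (1 : ℝ)).indicator (1 : ℝ → ℝ≥0∞) (B s ω + w) =
      (Ioi (1 - B s ω)).indicator 1 w := fun w ↦ by
    simp only [indicator_apply, mem_Ioi, sub_lt_iff_lt_add', Pi.one_apply]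
  simp only [G, this]
  rw [lintegral_const_mul _ (measurable_one.indicator measurableSet_Ioi),
    lintegral_indicator_one measurableSet_Ioi]
  ring

/-- The level `1` is almost surely reached. -/
lemma ae_exists_reached (hB : IsPreBrownianReal B P) (hm : ∀ t, Measurable (B t))
    (hc : ∀ ω, Continuous (B · ω)) (h0 : ∀ ω, B 0 ω = 0) :
    ∀ᵐ ω ∂P, ∃ n : ℕ, ω ∈ reached B n := by
  have := hB.isGaussianProcess.isProbabilityMeasure
  -- The hitting probability is `2 P(B_n > 1)`, which is `P(|B_n| > 1)` by symmetry.
  have hP : ∀ n : ℕ, n ≠ 0 → P (reached B n)ᶜ = gaussianReal 0 n (Icc (-1) 1) := fun n hn ↦ by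
    have hn' : (0 : ℝ≥0) < n := by positivity
    have h1 := lintegral_reached_diff hB hm hc h0 hn' (f := 1) measurable_one
    simp only [reached_zero h0, sdiff_empty, compl_empty, Measure.restrict_univ, h0, Pi.one_apply,
      lintegral_const, measure_univ, tsub_zero, one_mul, mul_one, Measure.restrict_apply,
      MeasurableSet.univ, univ_inter] at h1
    have h2 : gaussianReal 0 n (Icc (-1) 1)ᶜ = 2 * gaussianReal 0 n (Ioi 1) := by
      have : (Icc (-1 : ℝ) 1)ᶜ = Iio (-1) ∪ Ioi 1 := by
        ext x; simp only [mem_compl_iff, mem_Icc, not_and_or, not_le, mem_union, mem_Iio, mem_Ioi]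
      rw [this, measure_union _ measurableSet_Ioi, gaussianReal_Iio_neg, two_mul]
      exact Set.disjoint_left.2 fun x hx hx' ↦ by
        simp only [mem_Iio, mem_Ioi] at hx hx'; linarith
    rw [prob_compl_eq_one_sub (measurableSet_reached hc hm n), h1, ← h2,
      ← prob_compl_eq_one_sub measurableSet_Icc.compl, compl_compl]
  rw [ae_iff]
  refine le_antisymm (ge_of_tendsto tendsto_gaussianReal_Icc ?_) zero_le
  filter_upwards [eventually_ne_atTop 0] with n hn
  rw [← hP n hn]
  exact measure_mono fun ω hω h ↦ hω ⟨n, h⟩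

end

/-! ### Laplace transforms in time. -/

section

/-- Only the right limit of `g` at `c` is assumed, since the antiderivatives used below may be
singular there; `Function.update` inserts the limit as a value. -/
lemma lintegral_Ioi_of_hasDerivAt {g g' : ℝ → ℝ} {c a b : ℝ}
    (hderiv : ∀ x ∈ Ioi c, HasDerivAt g (g' x) x) (hpos : ∀ x ∈ Ioi c, 0 ≤ g' x)
    (ha : Tendsto g (𝓝[>] c) (𝓝 a)) (hb : Tendsto g atTop (𝓝 b)) :
    ∫⁻ x in Ioi c, ENNReal.ofReal (g' x) = ENNReal.ofReal (b - a) := by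
  have hcont : ContinuousWithinAt (Function.update g c a) (Ici c) c := by
    rw [continuousWithinAt_update_same, Ici_sdiff_left]
    exact ha
  have hderiv' : ∀ x ∈ Ioi c, HasDerivAt (Function.update g c a) (g' x) x := fun x hx ↦
    (hderiv x hx).congr_of_eventuallyEq (by
      filter_upwards [Ioi_mem_nhds hx] with y hy
      exact Function.update_of_ne (ne_of_gt hy) _ _)
  have hb' : Tendsto (Function.update g c a) atTop (𝓝 b) := hb.congr' (by
    filter_upwards [eventually_gt_atTop c] with y hy
    exact (Function.update_of_ne (ne_of_gt hy) _ _).symm)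
  rw [← ofReal_integral_eq_lintegral_ofReal
    (integrableOn_Ioi_deriv_of_nonneg hcont hderiv' hpos hb')
    ((ae_restrict_iff' measurableSet_Ioi).2 (ae_of_all _ hpos)),
    integral_Ioi_of_hasDerivAt_of_nonneg hcont hderiv' hpos hb', Function.update_self]

lemma lintegral_ofReal_sub_eq {α : Type*} [MeasurableSpace α] {μ : Measure α} {f g : α → ℝ}
    {a b : ℝ} (hg : Measurable g) (hg0 : ∀ᵐ x ∂μ, 0 ≤ g x)
    (hgf : ∀ᵐ x ∂μ, g x ≤ f x) (hfa : ∫⁻ x, ENNReal.ofReal (f x) ∂μ = ENNReal.ofReal a)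
    (hgb : ∫⁻ x, ENNReal.ofReal (g x) ∂μ = ENNReal.ofReal b) (hb : 0 ≤ b) :
    ∫⁻ x, ENNReal.ofReal (f x - g x) ∂μ = ENNReal.ofReal (a - b) := by
  rw [ENNReal.ofReal_sub _ hb, ← hfa, ← hgb,
    ← lintegral_sub' hg.ennreal_ofReal.aemeasurable (by rw [hgb]; exact ENNReal.ofReal_ne_top)
      (hgf.mono fun x hx ↦ ENNReal.ofReal_le_ofReal hx)]
  refine lintegral_congr_ae (hg0.mono fun x hx ↦ ?_)
  exact ENNReal.ofReal_sub _ hx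

lemma hasDerivAt_cdf_gaussianReal (x : ℝ) :
    HasDerivAt (cdf (gaussianReal 0 1)) (heat 1 x) x := by
  have hcont : Continuous (heat 1) := by unfold heat; fun_prop
  have hpdf : gaussianPDFReal 0 1 = heat 1 := by
    ext y; simp [gaussianPDFReal, heat]
  have hint : Integrable (heat 1) := hpdf ▸ integrable_gaussianPDFReal 0 1
  have hcdf : ∀ y, cdf (gaussianReal 0 1) y =
      (∫ z in Iic 0, heat 1 z) + ∫ z in (0 : ℝ)..y, heat 1 z := fun y ↦ by
    rw [← intervalIntegral.integral_Iic_sub_Iic hint.integrableOn hint.integrableOn,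
      add_sub_cancel, cdf_eq_real, measureReal_def, gaussianReal_apply_eq_heat one_ne_zero,
      integral_eq_lintegral_of_nonneg_ae (ae_of_all _ (heat_nonneg 1))
        hcont.aestronglyMeasurable]
    rfl
  rw [funext hcdf]
  exact (intervalIntegral.integral_hasDerivAt_right (hcont.intervalIntegrable _ _)
    (hcont.stronglyMeasurableAtFilter _ _) hcont.continuousAt).const_add _

lemma heat_abs (s x : ℝ) : heat s |x| = heat s x := by rw [heat, sq_abs, heat]

/-- Completing the square: `(b√s - a/√s)²/2 = b²s/2 - ab + a²/(2s)`. Taking `b = ±θ` handles both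
terms of the antiderivative in `lintegral_exp_mul_heat`. -/
lemma exp_mul_heat_one {s : ℝ} (hs : 0 < s) (b a : ℝ) :
    Real.exp (-(b * a)) * heat 1 (b * √s - a * (√s)⁻¹) =
      √s * (Real.exp (-(b ^ 2 / 2 * s)) * heat s a) := by
  have hq : 0 < √s := Real.sqrt_pos.2 hs
  have hqs : √s ^ 2 = s := Real.sq_sqrt hs.le
  have he : Real.exp (-(b * a)) * Real.exp (-(b * √s - a * (√s)⁻¹) ^ 2 / (2 * 1)) =
      Real.exp (-(b ^ 2 / 2 * s)) * Real.exp (-a ^ 2 / (2 * s)) := by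
    rw [← Real.exp_add, ← Real.exp_add]
    congr 1
    nth_rw 3 4 [← hqs]
    field_simp
    ring
  rw [heat, heat, mul_one, Real.sqrt_mul (by positivity) s, mul_inv]
  linear_combination (√(2 * Real.pi))⁻¹ * he +
    (√(2 * Real.pi))⁻¹ * (Real.exp (-(b ^ 2 / 2 * s)) * Real.exp (-a ^ 2 / (2 * s))) *
      (-mul_inv_cancel₀ hq.ne')

/-- The Laplace transform in time of the heat kernel. -/
lemma lintegral_exp_mul_heat {θ x : ℝ} (hθ : 0 < θ) (hx : x ≠ 0) :
    ∫⁻ s in Ioi 0, ENNReal.ofReal (Real.exp (-(θ ^ 2 / 2 * s)) * heat s x) =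
      ENNReal.ofReal (Real.exp (-(θ * |x|)) / θ) := by
  set a := |x| with ha
  have ha0 : 0 < a := abs_pos.2 hx
  let Φ : ℝ → ℝ := cdf (gaussianReal 0 1)
  -- An explicit antiderivative: on differentiating, the contributions of `a/√s` cancel between the
  -- two terms and those of `θ√s` add up.
  let g : ℝ → ℝ := fun s ↦ θ⁻¹ * (Real.exp (-(θ * a)) * Φ (θ * √s - a * (√s)⁻¹) -
    Real.exp (θ * a) * Φ (-(θ * √s) - a * (√s)⁻¹))
  have hsq0 : Tendsto (fun s : ℝ ↦ √s) (𝓝[>] 0) (𝓝 0) := by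
    have := (Real.continuous_sqrt.tendsto 0).mono_left (nhdsWithin_le_nhds (s := Ioi 0))
    rwa [Real.sqrt_zero] at this
  have hinv0 : Tendsto (fun s : ℝ ↦ a * (√s)⁻¹) (𝓝[>] 0) atTop := by
    refine (tendsto_inv_nhdsGT_zero.comp (tendsto_nhdsWithin_iff.2 ⟨hsq0, ?_⟩)).const_mul_atTop ha0
    filter_upwards [self_mem_nhdsWithin] with s hs using Real.sqrt_pos.2 hs
  have hsq1 : Tendsto (fun s : ℝ ↦ θ * √s) atTop atTop :=
    Real.tendsto_sqrt_atTop.const_mul_atTop hθ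
  have hinv1 : Tendsto (fun s : ℝ ↦ a * (√s)⁻¹) atTop (𝓝 0) := by
    simpa using (tendsto_inv_atTop_zero.comp Real.tendsto_sqrt_atTop).const_mul a
  have hbot : Tendsto Φ atBot (𝓝 0) := tendsto_cdf_atBot _
  have htop : Tendsto Φ atTop (𝓝 1) := tendsto_cdf_atTop _
  have hzero : Tendsto g (𝓝[>] 0) (𝓝 0) := by
    have h1 : Tendsto (fun s : ℝ ↦ θ * √s - a * (√s)⁻¹) (𝓝[>] 0) atBot := by
      simp only [sub_eq_add_neg]
      exact (hsq0.const_mul θ).add_atBot (tendsto_neg_atTop_atBot.comp hinv0)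
    have h2 : Tendsto (fun s : ℝ ↦ -(θ * √s) - a * (√s)⁻¹) (𝓝[>] 0) atBot := by
      simp only [sub_eq_add_neg]
      exact (hsq0.const_mul θ).neg.add_atBot (tendsto_neg_atTop_atBot.comp hinv0)
    have := (((hbot.comp h1).const_mul (Real.exp (-(θ * a)))).sub
      ((hbot.comp h2).const_mul (Real.exp (θ * a)))).const_mul θ⁻¹
    simpa using this
  have hinf : Tendsto g atTop (𝓝 (Real.exp (-(θ * a)) / θ)) := by
    have h1 : Tendsto (fun s : ℝ ↦ θ * √s - a * (√s)⁻¹) atTop atTop := by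
      simp only [sub_eq_add_neg]
      exact hsq1.atTop_add hinv1.neg
    have h2 : Tendsto (fun s : ℝ ↦ -(θ * √s) - a * (√s)⁻¹) atTop atBot := by
      simp only [sub_eq_add_neg]
      exact (tendsto_neg_atTop_atBot.comp hsq1).atBot_add hinv1.neg
    have := (((htop.comp h1).const_mul (Real.exp (-(θ * a)))).sub
      ((hbot.comp h2).const_mul (Real.exp (θ * a)))).const_mul θ⁻¹
    simpa [div_eq_inv_mul] using this
  have hderiv : ∀ s ∈ Ioi (0 : ℝ), HasDerivAt g (Real.exp (-(θ ^ 2 / 2 * s)) * heat s x) s := by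
    intro s hs
    have hs0 : (0 : ℝ) < s := hs
    have hq : 0 < √s := Real.sqrt_pos.2 hs0
    have hqs : √s ^ 2 = s := Real.sq_sqrt hs0.le
    have d1 := Real.hasDerivAt_sqrt hs0.ne'
    have d2 := (d1.inv hq.ne').const_mul a
    have e1 := (hasDerivAt_cdf_gaussianReal _).comp s ((d1.const_mul θ).sub d2)
    have e2 := (hasDerivAt_cdf_gaussianReal _).comp s ((d1.const_mul θ).neg.sub d2)
    have e3 := ((e1.const_mul (Real.exp (-(θ * a)))).sub
      (e2.const_mul (Real.exp (θ * a)))).const_mul θ⁻¹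
    refine e3.congr_deriv ?_
    have f1 := exp_mul_heat_one hs0 θ a
    have f2 := exp_mul_heat_one hs0 (-θ) a
    rw [neg_sq, neg_mul, neg_neg, neg_mul] at f2
    simp only [Pi.sub_apply, Pi.neg_apply, Pi.inv_apply]
    rw [← mul_assoc, ← mul_assoc, f1, f2, ← heat_abs s x]
    field_simp
    ring
  rw [lintegral_Ioi_of_hasDerivAt hderiv
    (fun s _ ↦ mul_nonneg (Real.exp_pos _).le (heat_nonneg _ _)) hzero hinf, sub_zero]

lemma exp_mul_heat_sub (θ s x : ℝ) : Real.exp (-(θ ^ 2 / 2 * s)) * killedHeat s x =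
    Real.exp (-(θ ^ 2 / 2 * s)) * heat s x - Real.exp (-(θ ^ 2 / 2 * s)) * heat s (2 - x) := by
  rw [killedHeat, mul_sub]

/-- The Laplace transform in time of the killed heat kernel. -/
lemma lintegral_exp_mul_killedHeat {θ x : ℝ} (hθ : 0 < θ) (hx : x ≠ 0) (hx1 : x < 1) :
    ∫⁻ s in Ioi 0, ENNReal.ofReal (Real.exp (-(θ ^ 2 / 2 * s)) * killedHeat s x) =
      ENNReal.ofReal (Real.exp (-(θ * |x|)) / θ - Real.exp (-(θ * (2 - x))) / θ) := by
  simp only [exp_mul_heat_sub]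
  have h2 := lintegral_exp_mul_heat hθ (x := 2 - x) (by linarith)
  rw [abs_of_pos (by linarith : 0 < 2 - x)] at h2
  refine lintegral_ofReal_sub_eq (by unfold heat; fun_prop)
    (ae_of_all _ fun s ↦ mul_nonneg (Real.exp_pos _).le (heat_nonneg _ _)) ?_
    (lintegral_exp_mul_heat hθ hx) h2 (by positivity)
  refine (ae_restrict_iff' measurableSet_Ioi).2 (ae_of_all _ fun s hs ↦ ?_)
  refine mul_le_mul_of_nonneg_left ?_ (Real.exp_pos _).le
  exact sub_nonneg.1 (killedHeat_nonneg (le_of_lt hs) hx1.le)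

lemma lintegral_Ioi_exp_neg_mul {r : ℝ} (hr : 0 < r) (a : ℝ) :
    ∫⁻ y in Ioi a, ENNReal.ofReal (Real.exp (-(r * y))) =
      ENNReal.ofReal (Real.exp (-(r * a)) / r) := by
  have h := lintegral_Ioi_of_hasDerivAt (g := fun y ↦ -(Real.exp (-(r * y)) / r))
    (g' := fun y ↦ Real.exp (-(r * y))) (c := a) (a := -(Real.exp (-(r * a)) / r)) (b := 0)
    (fun y _ ↦ ?_) (fun y _ ↦ (Real.exp_pos _).le) ?_ ?_
  · rw [h]; congr 1; ring
  · have := (((((hasDerivAt_id y).const_mul r).neg).exp).div_const r).neg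
    refine this.congr_deriv ?_
    simp only [id, Pi.neg_apply]
    field_simp
  · refine ((Continuous.tendsto ?_ a).mono_left nhdsWithin_le_nhds)
    fun_prop
  · have h1 : Tendsto (fun y : ℝ ↦ -(r * y)) atTop atBot :=
      tendsto_neg_atTop_atBot.comp (tendsto_id.const_mul_atTop hr)
    simpa using ((Real.tendsto_exp_atBot.comp h1).div_const r).neg

/-- The Laplace transform of the distribution function of a hitting time. -/
lemma lintegral_exp_mul_gaussianReal_Ioi {θ a : ℝ} (hθ : 0 < θ) (ha : 0 < a) :
    ∫⁻ v in Ioi (0 : ℝ), ENNReal.ofReal (Real.exp (-(θ ^ 2 / 2 * v))) *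
        (2 * gaussianReal 0 v.toNNReal (Ioi a)) =
      ENNReal.ofReal (2 * (Real.exp (-(θ * a)) / θ ^ 2)) := by
  have hmeas : Measurable fun q : ℝ × ℝ ↦
      ENNReal.ofReal (Real.exp (-(θ ^ 2 / 2 * q.1)) * heat q.1 q.2) := by
    unfold heat; fun_prop
  -- The Gaussian tail is an integral of the heat kernel over `y > a`; exchanging the order reduces
  -- to the transform of the heat kernel.
  calc _ = ∫⁻ v in Ioi (0 : ℝ), ∫⁻ y in Ioi a,
        2 * ENNReal.ofReal (Real.exp (-(θ ^ 2 / 2 * v)) * heat v y) := by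
        refine setLIntegral_congr_fun measurableSet_Ioi fun v hv ↦ ?_
        have hv0 : (0 : ℝ) < v := hv
        rw [lintegral_const_mul _ (by unfold heat; fun_prop),
          gaussianReal_apply_eq_heat (by simpa using hv0), Real.coe_toNNReal _ hv0.le,
          mul_left_comm, ← lintegral_const_mul _ (by unfold heat; fun_prop)]
        simp only [ENNReal.ofReal_mul (Real.exp_pos _).le]
    _ = ∫⁻ y in Ioi a, ∫⁻ v in Ioi (0 : ℝ),
        2 * ENNReal.ofReal (Real.exp (-(θ ^ 2 / 2 * v)) * heat v y) :=
        lintegral_lintegral_swap (hmeas.const_mul 2).aemeasurable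
    _ = ∫⁻ y in Ioi a, ENNReal.ofReal (2 / θ) * ENNReal.ofReal (Real.exp (-(θ * y))) := by
        refine setLIntegral_congr_fun measurableSet_Ioi fun y hy ↦ ?_
        have hy0 : 0 < y := ha.trans hy
        rw [lintegral_const_mul _ (by unfold heat; fun_prop),
          lintegral_exp_mul_heat hθ hy0.ne', abs_of_pos hy0, ← ENNReal.ofReal_mul (by positivity),
          ← ENNReal.ofReal_ofNat, ← ENNReal.ofReal_mul (by positivity)]
        congr 1; ring
    _ = _ := by
        rw [lintegral_const_mul _ (by fun_prop), lintegral_Ioi_exp_neg_mul hθ,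
          ← ENNReal.ofReal_mul (by positivity)]
        congr 1; field_simp

lemma integrableOn_rpow_mul_exp_neg {m b : ℝ} (hm : 0 ≤ m) (hb : 0 < b) :
    IntegrableOn (fun θ : ℝ ↦ θ ^ m * Real.exp (-(b * θ))) (Ioi 0) := by
  have := integrableOn_rpow_mul_exp_neg_mul_rpow (p := 1) (s := m) (by linarith) one_pos hb
  simpa using this

lemma lintegral_rpow_mul_exp_neg {m b : ℝ} (hm : 0 ≤ m) (hb : 0 < b) :
    ∫⁻ θ in Ioi (0 : ℝ), ENNReal.ofReal (θ ^ m * Real.exp (-(b * θ))) =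
      ENNReal.ofReal (Real.Gamma (m + 1) * b ^ (-(m + 1))) := by
  rw [← ofReal_integral_eq_lintegral_ofReal (integrableOn_rpow_mul_exp_neg hm hb)]
  · have := Real.integral_rpow_mul_exp_neg_mul_Ioi (a := m + 1) (r := b) (by linarith) hb
    rw [add_sub_cancel_right] at this
    rw [this, one_div, Real.inv_rpow hb.le, Real.rpow_neg hb.le, mul_comm]
  · refine (ae_restrict_iff' measurableSet_Ioi).2 (ae_of_all _ fun θ hθ ↦ ?_)
    exact mul_nonneg (Real.rpow_nonneg (le_of_lt hθ) _) (Real.exp_pos _).le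

lemma lintegral_rpow_mul_exp_neg_sub {m b b' : ℝ} (hm : 0 ≤ m) (hb : 0 < b) (hbb' : b ≤ b') :
    ∫⁻ θ in Ioi (0 : ℝ), ENNReal.ofReal
        (θ ^ m * Real.exp (-(b * θ)) - θ ^ m * Real.exp (-(b' * θ))) =
      ENNReal.ofReal (Real.Gamma (m + 1) * b ^ (-(m + 1)) -
        Real.Gamma (m + 1) * b' ^ (-(m + 1))) := by
  have hb' := hb.trans_le hbb'
  refine lintegral_ofReal_sub_eq (by fun_prop) ?_ ?_ (lintegral_rpow_mul_exp_neg hm hb)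
    (lintegral_rpow_mul_exp_neg hm hb') ?_
  · refine (ae_restrict_iff' measurableSet_Ioi).2 (ae_of_all _ fun θ hθ ↦ ?_)
    exact mul_nonneg (Real.rpow_nonneg (le_of_lt hθ) _) (Real.exp_pos _).le
  · refine (ae_restrict_iff' measurableSet_Ioi).2 (ae_of_all _ fun θ hθ ↦ ?_)
    have hθ0 : (0 : ℝ) ≤ θ := le_of_lt hθ
    gcongr
  · exact mul_nonneg (Real.Gamma_pos_of_pos (by linarith)).le (Real.rpow_nonneg hb'.le _)

/-- The power `t ^ (-(1 + m / 2))` as a superposition of exponentials. -/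
lemma lintegral_rpow_mul_exp_neg_sq {m t : ℝ} (hm : 0 ≤ m) (ht : 0 < t) :
    ∫⁻ θ in Ioi (0 : ℝ), ENNReal.ofReal (θ ^ (m + 1) * Real.exp (-(θ ^ 2 / 2 * t))) =
      ENNReal.ofReal (2 ^ (m / 2) * Real.Gamma (1 + m / 2) * t ^ (-(1 + m / 2))) := by
  have e : ∀ θ : ℝ, -(θ ^ 2 / 2 * t) = -(t / 2) * θ ^ (2 : ℝ) := fun θ ↦ by
    rw [Real.rpow_two]; ring
  simp only [e]
  rw [← ofReal_integral_eq_lintegral_ofReal]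
  · rw [integral_rpow_mul_exp_neg_mul_rpow two_pos (by linarith) (by linarith)]
    have h1 : (m + 1 + 1) / 2 = 1 + m / 2 := by ring
    have h2 : -(m + 1 + 1) / 2 = -(1 + m / 2) := by ring
    rw [h1, h2, Real.div_rpow ht.le two_pos.le, Real.rpow_neg two_pos.le, Real.rpow_add two_pos,
      Real.rpow_one]
    congr 1
    field_simp
  · have := integrableOn_rpow_mul_exp_neg_mul_rpow (p := 2) (s := m + 1) (b := t / 2)
      (by linarith) two_pos (by linarith)
    exact this
  · refine (ae_restrict_iff' measurableSet_Ioi).2 (ae_of_all _ fun θ hθ ↦ ?_)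
    exact mul_nonneg (Real.rpow_nonneg (le_of_lt hθ) _) (Real.exp_pos _).le

end

/-! ### Expectations of additive functionals up to the hitting time. -/

section

/-- By scaling, this is the standard Gaussian measure of a section of one measurable set, hence
jointly measurable in variance and level. -/
lemma measurable_gaussianReal_Ioi :
    Measurable fun q : ℝ × ℝ ↦ gaussianReal 0 q.1.toNNReal (Ioi (1 - q.2)) := by
  have h : ∀ q : ℝ × ℝ, gaussianReal 0 q.1.toNNReal (Ioi (1 - q.2)) =
      gaussianReal 0 1 (Prod.mk q ⁻¹' {p : (ℝ × ℝ) × ℝ | 1 - p.1.2 < √p.1.1.toNNReal * p.2}) := by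
    intro q
    have := gaussianReal_map_const_mul (μ := 0) (v := 1) (√(q.1.toNNReal : ℝ))
    have hv : NNReal.mk (√(q.1.toNNReal : ℝ) ^ 2) (sq_nonneg _) * 1 = q.1.toNNReal := by
      rw [mul_one]
      exact NNReal.eq (Real.sq_sqrt (NNReal.coe_nonneg _))
    rw [mul_zero, hv] at this
    rw [← this, Measure.map_apply (by fun_prop) measurableSet_Ioi]
    rfl
  simp only [h]
  refine measurable_measure_prodMk_left ?_
  exact measurableSet_lt (by fun_prop) (by fun_prop)

/-- Writing `exp(-ct)` as the integral of `c exp(-cr)` over `r ≥ t`, with `r = s + v`, replaces a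
discount at the hitting time by the events that the hit occurs by time `s + v`. -/
lemma lintegral_indicator_exp {c s t : ℝ} (hc : 0 < c) (hst : s < t) :
    ∫⁻ v in Ioi (0 : ℝ), {v | t ≤ s + v}.indicator
        (fun v ↦ ENNReal.ofReal (c * Real.exp (-(c * (s + v))))) v =
      ENNReal.ofReal (Real.exp (-(c * t))) := by
  have hset : {v : ℝ | t ≤ s + v} = Ici (t - s) := by
    ext v; simp [add_comm s]
  have hinter : Ici (t - s) ∩ Ioi 0 = Ici (t - s) :=
    inter_eq_left.2 fun v hv ↦ (sub_pos.2 hst).trans_le hv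
  rw [hset, lintegral_indicator measurableSet_Ici, Measure.restrict_restrict measurableSet_Ici,
    hinter, ← setLIntegral_congr Ioi_ae_eq_Ici]
  have h : ∀ v : ℝ, ENNReal.ofReal (c * Real.exp (-(c * (s + v)))) =
      ENNReal.ofReal (c * Real.exp (-(c * s))) * ENNReal.ofReal (Real.exp (-(c * v))) := by
    intro v
    rw [← ENNReal.ofReal_mul (by positivity), mul_assoc, ← Real.exp_add]
    ring_nf
  simp only [h]
  rw [lintegral_const_mul _ (by fun_prop), lintegral_Ioi_exp_neg_mul hc,
    ← ENNReal.ofReal_mul (by positivity)]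
  congr 1
  rw [mul_div_assoc', mul_assoc, ← Real.exp_add, mul_div_cancel_left₀ _ hc.ne']
  ring_nf

variable {Ω : Type*} {B : ℝ≥0 → Ω → ℝ}

lemma T₁_nonneg (B : ℝ≥0 → Ω → ℝ) (ω : Ω) : 0 ≤ T₁ B ω := NNReal.coe_nonneg _

lemma T₁_spec {ω : Ω} (hc : Continuous (B · ω)) (h0 : B 0 ω = 0) {u : ℝ≥0}
    (h : ω ∈ reached B u) :
    hit B ω ≠ ⊤ ∧ 0 < T₁ B ω ∧ ∀ r : ℝ≥0, ω ∈ reached B r ↔ T₁ B ω ≤ r := by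
  obtain ⟨T, -, hT0, hT, hhit⟩ := exists_first_hit hc h0 h
  have hT₁ : T₁ B ω = T := by rw [T₁, hhit]; rfl
  refine ⟨by rw [hhit]; exact WithTop.coe_ne_top, by rw [hT₁]; exact_mod_cast hT0, fun r ↦ ?_⟩
  rw [hT, hT₁, NNReal.coe_le_coe]

lemma T₁_eq_zero {ω : Ω} (h : ∀ n : ℕ, ω ∉ reached B n) : T₁ B ω = 0 := by
  have : hit B ω = ⊤ := by
    rw [hit, hittingAfter_eq_top_iff]
    intro j _ hj
    obtain ⟨n, hn⟩ := exists_nat_ge j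
    exact h n ⟨j, hn, ge_of_eq hj⟩
  rw [T₁, this]; rfl

variable [MeasurableSpace Ω] {P : Measure Ω}

lemma measurable_T₁ (hm : ∀ t, Measurable (B t)) (hc : ∀ ω, Continuous (B · ω))
    (h0 : ∀ ω, B 0 ω = 0) : Measurable (T₁ B) := by
  refine measurable_of_Iic fun a ↦ ?_
  rcases lt_or_ge a 0 with ha | ha
  · have : T₁ B ⁻¹' Iic a = ∅ := by
      ext ω
      simpa using ha.trans_le (T₁_nonneg B ω)
    rw [this]; exact MeasurableSet.empty
  -- Paths that never reach `1` carry the default value `0` of `T₁`, so they belong to this sublevel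
  -- set.
  · have : T₁ B ⁻¹' Iic a = reached B a.toNNReal ∪ (⋃ n : ℕ, reached B n)ᶜ := by
      ext ω
      simp only [mem_preimage, mem_Iic, mem_union, mem_compl_iff, mem_iUnion]
      by_cases h : ∃ n : ℕ, ω ∈ reached B n
      · obtain ⟨n, hn⟩ := h
        rw [(T₁_spec (hc ω) (h0 ω) hn).2.2, Real.coe_toNNReal _ ha]
        exact ⟨Or.inl, fun h ↦ h.resolve_right fun h ↦ h ⟨n, hn⟩⟩
      · rw [T₁_eq_zero (not_exists.1 h)]
        exact ⟨fun _ ↦ Or.inr h, fun _ ↦ ha⟩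
    rw [this]
    exact (measurableSet_reached hc hm _).union
      (MeasurableSet.iUnion fun n ↦ measurableSet_reached hc hm _).compl

lemma ae_T₁_spec (hB : IsPreBrownianReal B P) (hm : ∀ t, Measurable (B t))
    (hc : ∀ ω, Continuous (B · ω)) (h0 : ∀ ω, B 0 ω = 0) :
    ∀ᵐ ω ∂P, hit B ω ≠ ⊤ ∧ 0 < T₁ B ω ∧ ∀ r : ℝ≥0, ω ∈ reached B r ↔ T₁ B ω ≤ r := by
  filter_upwards [ae_exists_reached hB hm hc h0] with ω ⟨n, hn⟩
  exact T₁_spec (hc ω) (h0 ω) hn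

lemma measurable_uncurry_path (hm : ∀ t, Measurable (B t)) (hc : ∀ ω, Continuous (B · ω)) :
    Measurable fun q : Ω × ℝ ↦ B q.2.toNNReal q.1 := by
  have h := measurable_uncurry_of_continuous_of_measurable (u := B) hc hm
  exact h.comp ((measurable_real_toNNReal.comp measurable_snd).prodMk measurable_fst)

/-- The expected value of `f (B s)` at a fixed time `s < T₁`, discounted at the hitting time. -/
lemma lintegral_discounted (hB : IsPreBrownianReal B P) (hm : ∀ t, Measurable (B t))
    (hc : ∀ ω, Continuous (B · ω)) (h0 : ∀ ω, B 0 ω = 0) {f : ℝ → ℝ≥0∞} (hf : Measurable f)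
    {s θ : ℝ} (hs : 0 < s) (hθ : 0 < θ) :
    ∫⁻ ω, {ω | s < T₁ B ω}.indicator
        (fun ω ↦ ENNReal.ofReal (Real.exp (-(θ ^ 2 / 2 * T₁ B ω))) * f (B s.toNNReal ω)) ω ∂P =
      ∫⁻ x in Iio 1, f x * (ENNReal.ofReal (Real.exp (-(θ ^ 2 / 2 * s)) * killedHeat s x) *
        ENNReal.ofReal (Real.exp (-(θ * (1 - x))))) := by
  have := hB.isGaussianProcess.isProbabilityMeasure
  have hT := measurable_T₁ hm hc h0
  have hcs : 0 < θ ^ 2 / 2 := by positivity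
  set k : ℝ → ℝ≥0∞ := fun v ↦
    ENNReal.ofReal (θ ^ 2 / 2 * Real.exp (-(θ ^ 2 / 2 * (s + v)))) with hk
  have hkm : Measurable k := by fun_prop
  have hs' : s.toNNReal ≠ 0 := by simpa using hs
  calc _ = ∫⁻ ω, (∫⁻ v in Ioi (0 : ℝ),
        {q : Ω × ℝ | s < T₁ B q.1 ∧ T₁ B q.1 ≤ s + q.2}.indicator
          (fun q ↦ k q.2 * f (B s.toNNReal q.1)) (ω, v)) ∂P := by
        refine lintegral_congr fun ω ↦ ?_
        by_cases h : s < T₁ B ω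
        · have hset : MeasurableSet {v | T₁ B ω ≤ s + v} :=
            measurableSet_le measurable_const (by fun_prop)
          rw [indicator_of_mem (by exact h), ← lintegral_indicator_exp hcs h,
            ← lintegral_mul_const _ (Measurable.indicator (by fun_prop) hset)]
          refine lintegral_congr fun v ↦ ?_
          by_cases h' : T₁ B ω ≤ s + v <;> simp [indicator, h, h', k]
        · simp [indicator, h]
    _ = ∫⁻ v in Ioi (0 : ℝ), ∫⁻ ω,
        {q : Ω × ℝ | s < T₁ B q.1 ∧ T₁ B q.1 ≤ s + q.2}.indicator
          (fun q ↦ k q.2 * f (B s.toNNReal q.1)) (ω, v) ∂P := by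
        refine lintegral_lintegral_swap (Measurable.aemeasurable ?_)
        refine Measurable.indicator ?_ ?_
        · exact (hkm.comp measurable_snd).mul (hf.comp ((hm _).comp measurable_fst))
        · exact (measurableSet_lt measurable_const (hT.comp measurable_fst)).inter
            (measurableSet_le (hT.comp measurable_fst) (measurable_snd.const_add s))
    _ = ∫⁻ v in Ioi (0 : ℝ), ∫⁻ x in Iio 1, ENNReal.ofReal (killedHeat s x) * f x *
        (k v * (2 * gaussianReal 0 v.toNNReal (Ioi (1 - x)))) := by
        refine setLIntegral_congr_fun measurableSet_Ioi fun v hv ↦ ?_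
        have hv0 : (0 : ℝ) < v := hv
        have hlt : s.toNNReal < (s + v).toNNReal :=
          (Real.toNNReal_lt_toNNReal_iff (by positivity)).2 (by linarith)
        have hsub : (s + v).toNNReal - s.toNNReal = v.toNNReal := by
          rw [Real.toNNReal_add hs.le hv0.le, add_tsub_cancel_left]
        have hγ : Measurable fun x ↦ 2 * gaussianReal 0 v.toNNReal (Ioi (1 - x)) :=
          (measurable_gaussianReal_Ioi.comp (measurable_const.prodMk measurable_id)).const_mul 2
        have h1 := lintegral_reached_diff hB hm hc h0 hlt hf
        rw [hsub, lintegral_compl_reached hB hm hc h0 hs' (f := fun x ↦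
          f x * (2 * gaussianReal 0 v.toNNReal (Ioi (1 - x)))) (hf.mul hγ),
          Real.coe_toNNReal _ hs.le, ← lintegral_indicator
            ((measurableSet_reached hc hm _).diff (measurableSet_reached hc hm _))] at h1
        calc _ = ∫⁻ ω, k v * (reached B (s + v).toNNReal \ reached B s.toNNReal).indicator
              (fun ω ↦ f (B s.toNNReal ω)) ω ∂P := by
              refine lintegral_congr_ae ?_
              filter_upwards [ae_T₁_spec hB hm hc h0] with ω hω
              have e1 := hω.2.2 s.toNNReal
              have e2 := hω.2.2 (s + v).toNNReal
              rw [Real.coe_toNNReal _ (by positivity)] at e1 e2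
              by_cases a1 : T₁ B ω ≤ s
              · simp [indicator, e1, a1, a1.not_gt]
              · by_cases a2 : T₁ B ω ≤ s + v
                · simp [indicator, e1, e2, a1, a2, not_le.1 a1]
                · simp [indicator, e2, a2]
          _ = _ := by
              rw [lintegral_const_mul' _ _ ENNReal.ofReal_ne_top, h1,
                ← lintegral_const_mul' _ _ ENNReal.ofReal_ne_top]
              refine lintegral_congr fun x ↦ ?_
              ring
    _ = ∫⁻ x in Iio 1, ∫⁻ v in Ioi (0 : ℝ), ENNReal.ofReal (killedHeat s x) * f x *
        (k v * (2 * gaussianReal 0 v.toNNReal (Ioi (1 - x)))) := by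
        refine lintegral_lintegral_swap (Measurable.aemeasurable ?_)
        refine Measurable.mul (Measurable.mul ?_ (hf.comp measurable_snd))
          ((hkm.comp measurable_fst).mul (measurable_gaussianReal_Ioi.const_mul 2))
        unfold killedHeat heat
        fun_prop
    -- The `v`-integral of the Gaussian tails yields `2 exp(-θ(1-x))/θ²`, and the factor `θ²/2`
    -- inside `k` normalises it.
    _ = _ := by
        refine setLIntegral_congr_fun measurableSet_Iio fun x hx ↦ ?_
        have hx1 : 0 < 1 - x := sub_pos.2 hx
        have hkv : ∀ v, k v = ENNReal.ofReal (θ ^ 2 / 2 * Real.exp (-(θ ^ 2 / 2 * s))) *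
            ENNReal.ofReal (Real.exp (-(θ ^ 2 / 2 * v))) := fun v ↦ by
          rw [← ENNReal.ofReal_mul (by positivity), mul_assoc, ← Real.exp_add, hk]
          ring_nf
        have hγ : Measurable fun v : ℝ ↦ gaussianReal 0 v.toNNReal (Ioi (1 - x)) :=
          measurable_gaussianReal_Ioi.comp (measurable_id.prodMk measurable_const)
        have hmm : Measurable fun v : ℝ ↦ ENNReal.ofReal (Real.exp (-(θ ^ 2 / 2 * v))) *
            (2 * gaussianReal 0 v.toNNReal (Ioi (1 - x))) :=
          Measurable.mul (by fun_prop) (hγ.const_mul 2)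
        have hk0 := killedHeat_nonneg hs.le (le_of_lt hx)
        simp only [hkv, mul_assoc]
        rw [lintegral_const_mul _ (by fun_prop), lintegral_const_mul _ (by fun_prop),
          lintegral_const_mul _ hmm, lintegral_exp_mul_gaussianReal_Ioi hθ hx1,
          mul_left_comm]
        congr 1
        rw [← ENNReal.ofReal_mul (by positivity), ← ENNReal.ofReal_mul hk0,
          ← ENNReal.ofReal_mul (mul_nonneg (Real.exp_pos _).le hk0)]
        congr 1
        field_simp

/-- The expected discounted additive functional of the path up to the hitting time. -/
lemma lintegral_discounted_functional (hB : IsPreBrownianReal B P) (hm : ∀ t, Measurable (B t))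
    (hc : ∀ ω, Continuous (B · ω)) (h0 : ∀ ω, B 0 ω = 0) {f : ℝ → ℝ≥0∞} (hf : Measurable f)
    {θ : ℝ} (hθ : 0 < θ) :
    ∫⁻ ω, ENNReal.ofReal (Real.exp (-(θ ^ 2 / 2 * T₁ B ω))) *
        (∫⁻ s in Ioo 0 (T₁ B ω), f (B s.toNNReal ω)) ∂P =
      ∫⁻ x in Iio 1, f x * ENNReal.ofReal
        ((Real.exp (-(θ * |x|)) / θ - Real.exp (-(θ * (2 - x))) / θ) *
          Real.exp (-(θ * (1 - x)))) := by
  have := hB.isGaussianProcess.isProbabilityMeasure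
  have hT := measurable_T₁ hm hc h0
  have hpath := measurable_uncurry_path hm hc
  calc _ = ∫⁻ ω, (∫⁻ s in Ioi (0 : ℝ), {q : Ω × ℝ | q.2 < T₁ B q.1}.indicator
        (fun q ↦ ENNReal.ofReal (Real.exp (-(θ ^ 2 / 2 * T₁ B q.1))) *
          f (B q.2.toNNReal q.1)) (ω, s)) ∂P := by
        refine lintegral_congr fun ω ↦ ?_
        rw [← lintegral_const_mul' _ _ ENNReal.ofReal_ne_top, ← Iio_inter_Ioi,
          ← Measure.restrict_restrict measurableSet_Iio, ← lintegral_indicator measurableSet_Iio]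
        refine lintegral_congr fun s ↦ ?_
        simp only [indicator, mem_Iio, mem_ofPred_eq]
    _ = ∫⁻ s in Ioi (0 : ℝ), ∫⁻ ω, {q : Ω × ℝ | q.2 < T₁ B q.1}.indicator
        (fun q ↦ ENNReal.ofReal (Real.exp (-(θ ^ 2 / 2 * T₁ B q.1))) *
          f (B q.2.toNNReal q.1)) (ω, s) ∂P := by
        refine lintegral_lintegral_swap (Measurable.aemeasurable ?_)
        refine Measurable.indicator ?_ (measurableSet_lt measurable_snd (hT.comp measurable_fst))
        have hT' : Measurable fun q : Ω × ℝ ↦ T₁ B q.1 := hT.comp measurable_fst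
        exact Measurable.mul (by fun_prop) (hf.comp hpath)
    _ = ∫⁻ s in Ioi (0 : ℝ), ∫⁻ x in Iio 1,
        f x * (ENNReal.ofReal (Real.exp (-(θ ^ 2 / 2 * s)) * killedHeat s x) *
        ENNReal.ofReal (Real.exp (-(θ * (1 - x))))) :=
        setLIntegral_congr_fun measurableSet_Ioi fun s hs ↦
          lintegral_discounted hB hm hc h0 hf hs hθ
    _ = ∫⁻ x in Iio 1, ∫⁻ s in Ioi (0 : ℝ),
        f x * (ENNReal.ofReal (Real.exp (-(θ ^ 2 / 2 * s)) * killedHeat s x) *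
        ENNReal.ofReal (Real.exp (-(θ * (1 - x))))) := by
        refine lintegral_lintegral_swap (Measurable.aemeasurable ?_)
        refine (hf.comp measurable_snd).mul ?_
        unfold killedHeat heat
        fun_prop
    _ = _ := by
        refine lintegral_congr_ae ?_
        -- The transform of the killed kernel is available only off the starting point, a null set
        -- of positions.
        have hne : ∀ᵐ x : ℝ ∂volume.restrict (Iio 1), x ≠ 0 :=
          ae_restrict_of_ae (Measure.ae_ne volume 0)
        filter_upwards [hne, ae_restrict_mem measurableSet_Iio] with x hx0 hx1
        have hkm : Measurable fun s : ℝ ↦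
            ENNReal.ofReal (Real.exp (-(θ ^ 2 / 2 * s)) * killedHeat s x) := by
          unfold killedHeat heat; fun_prop
        rw [lintegral_const_mul _ (hkm.mul_const _), lintegral_mul_const _ hkm,
          lintegral_exp_mul_killedHeat hθ hx0 hx1, ← ENNReal.ofReal_mul' (Real.exp_pos _).le]

/-- The expectation of a scaled additive functional of the path up to the hitting time. -/
lemma lintegral_scaled_functional (hB : IsPreBrownianReal B P) (hm : ∀ t, Measurable (B t))
    (hc : ∀ ω, Continuous (B · ω)) (h0 : ∀ ω, B 0 ω = 0) {f : ℝ → ℝ≥0∞} (hf : Measurable f)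
    {m : ℝ} (hm0 : 0 ≤ m) :
    ∫⁻ ω, ENNReal.ofReal (2 ^ (m / 2) * Real.Gamma (1 + m / 2) * T₁ B ω ^ (-(1 + m / 2))) *
        (∫⁻ s in Ioo 0 (T₁ B ω), f (B s.toNNReal ω)) ∂P =
      ∫⁻ x in Iio 1, f x * ENNReal.ofReal
        (Real.Gamma (m + 1) * (|x| + (1 - x)) ^ (-(m + 1)) -
          Real.Gamma (m + 1) * (3 - 2 * x) ^ (-(m + 1))) := by
  have := hB.isGaussianProcess.isProbabilityMeasure
  have hT := measurable_T₁ hm hc h0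
  have hpath := measurable_uncurry_path hm hc
  have hF : Measurable fun ω ↦ ∫⁻ s in Ioo 0 (T₁ B ω), f (B s.toNNReal ω) := by
    have h1 : ∀ ω, ∫⁻ s in Ioo 0 (T₁ B ω), f (B s.toNNReal ω) =
        ∫⁻ s, {q : Ω × ℝ | 0 < q.2 ∧ q.2 < T₁ B q.1}.indicator
          (fun q ↦ f (B q.2.toNNReal q.1)) (ω, s) := fun ω ↦ by
      rw [← lintegral_indicator measurableSet_Ioo]
      rfl
    simp only [h1]
    refine Measurable.lintegral_prod_right' ((hf.comp hpath).indicator ?_)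
    exact (measurableSet_lt measurable_const measurable_snd).inter
      (measurableSet_lt measurable_snd (hT.comp measurable_fst))
  calc _ = ∫⁻ ω, (∫⁻ θ in Ioi (0 : ℝ), ENNReal.ofReal (θ ^ (m + 1)) *
        (ENNReal.ofReal (Real.exp (-(θ ^ 2 / 2 * T₁ B ω))) *
        (∫⁻ s in Ioo 0 (T₁ B ω), f (B s.toNNReal ω)))) ∂P := by
        refine lintegral_congr_ae ?_
        filter_upwards [ae_T₁_spec hB hm hc h0] with ω hω
        rw [← lintegral_rpow_mul_exp_neg_sq hm0 hω.2.1,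
          ← lintegral_mul_const _ (by fun_prop)]
        refine setLIntegral_congr_fun measurableSet_Ioi fun θ hθ ↦ ?_
        rw [ENNReal.ofReal_mul (Real.rpow_nonneg (le_of_lt hθ) _), mul_assoc]
    _ = ∫⁻ θ in Ioi (0 : ℝ), ∫⁻ ω, ENNReal.ofReal (θ ^ (m + 1)) *
        (ENNReal.ofReal (Real.exp (-(θ ^ 2 / 2 * T₁ B ω))) *
        (∫⁻ s in Ioo 0 (T₁ B ω), f (B s.toNNReal ω))) ∂P := by
        refine lintegral_lintegral_swap (Measurable.aemeasurable ?_)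
        have hT' : Measurable fun q : Ω × ℝ ↦ T₁ B q.1 := hT.comp measurable_fst
        exact Measurable.mul (by fun_prop) (Measurable.mul (by fun_prop) (hF.comp measurable_fst))
    _ = ∫⁻ θ in Ioi (0 : ℝ), ∫⁻ x in Iio 1, f x * ENNReal.ofReal
        (θ ^ m * Real.exp (-((|x| + (1 - x)) * θ)) -
          θ ^ m * Real.exp (-((3 - 2 * x) * θ))) := by
        refine setLIntegral_congr_fun measurableSet_Ioi fun θ hθ ↦ ?_
        have hθ0 : (0 : ℝ) < θ := hθ
        rw [lintegral_const_mul' _ _ ENNReal.ofReal_ne_top,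
          lintegral_discounted_functional hB hm hc h0 hf hθ,
          ← lintegral_const_mul' _ _ ENNReal.ofReal_ne_top]
        refine lintegral_congr fun x ↦ ?_
        rw [mul_left_comm, ← ENNReal.ofReal_mul (Real.rpow_nonneg hθ0.le _)]
        congr 2
        -- The two rates are `|x|` and `2 - x` from the Green function, each increased by `1 - x`
        -- from the remaining time to the hit.
        have e1 : Real.exp (-((|x| + (1 - x)) * θ)) =
            Real.exp (-(θ * |x|)) * Real.exp (-(θ * (1 - x))) := by
          rw [← Real.exp_add]; ring_nf
        have e2 : Real.exp (-((3 - 2 * x) * θ)) =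
            Real.exp (-(θ * (2 - x))) * Real.exp (-(θ * (1 - x))) := by
          rw [← Real.exp_add]; ring_nf
        rw [e1, e2, Real.rpow_add hθ0, Real.rpow_one]
        field_simp
    _ = ∫⁻ x in Iio 1, ∫⁻ θ in Ioi (0 : ℝ), f x * ENNReal.ofReal
        (θ ^ m * Real.exp (-((|x| + (1 - x)) * θ)) -
          θ ^ m * Real.exp (-((3 - 2 * x) * θ))) := by
        refine lintegral_lintegral_swap (Measurable.aemeasurable ?_)
        exact (hf.comp measurable_snd).mul (by fun_prop)
    _ = _ := by
        refine setLIntegral_congr_fun measurableSet_Iio fun x hx ↦ ?_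
        have hx1 : x < 1 := hx
        have habs := abs_nonneg x
        have habs' : |x| + (1 - x) ≤ 3 - 2 * x := by
          rcases abs_cases x with h | h <;> linarith
        rw [lintegral_const_mul _ (by fun_prop),
          lintegral_rpow_mul_exp_neg_sub hm0 (by linarith) habs']

end

/-! ### Gaussian moments and the two spatial integrals. -/

section

lemma c_eq_gamma_half {m : ℝ} (hm : 0 ≤ m) :
    c m = 1 / √Real.pi * (2 : ℝ) ^ (m / 2) * Real.Gamma ((1 + m) / 2) := by
  have h1 : ∀ x : ℝ, gaussianPDFReal 0 1 x • |x| ^ m =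
      (fun y ↦ (√(2 * Real.pi))⁻¹ * (y ^ m * Real.exp (-(1 / 2) * y ^ (2 : ℝ)))) |x| := fun x ↦ by
    simp only [gaussianPDFReal, NNReal.coe_one, mul_one, sub_zero, smul_eq_mul, Real.rpow_two,
      sq_abs]
    ring_nf
  rw [c, integral_gaussianReal_eq_integral_smul one_ne_zero, integral_congr_ae (ae_of_all _ h1),
    integral_comp_abs (f := fun y ↦
      (√(2 * Real.pi))⁻¹ * (y ^ m * Real.exp (-(1 / 2) * y ^ (2 : ℝ)))),
    integral_const_mul, integral_rpow_mul_exp_neg_mul_rpow two_pos (by linarith) (by norm_num),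
    Real.sqrt_mul two_pos.le, one_div (2 : ℝ), Real.inv_rpow two_pos.le, neg_div,
    Real.rpow_neg two_pos.le, inv_inv, add_div, Real.rpow_add two_pos, ← Real.sqrt_eq_rpow,
    ← add_div, add_comm m 1]
  field_simp

lemma c_pos {m : ℝ} (hm : 0 ≤ m) : 0 < c m := by
  rw [c_eq_gamma_half hm]
  have := Real.Gamma_pos_of_pos (s := (1 + m) / 2) (by linarith)
  positivity

/-- Legendre's duplication formula at `(1 + m)/2`. -/
lemma c_eq_gamma_div {m : ℝ} (hm : 0 ≤ m) :
    c m = Real.Gamma (1 + m) / ((2 : ℝ) ^ (m / 2) * Real.Gamma (1 + m / 2)) := by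
  have h1 := Real.Gamma_pos_of_pos (s := 1 + m / 2) (by linarith)
  have h2 := Real.Gamma_mul_Gamma_add_half ((1 + m) / 2)
  have e1 : (1 + m) / 2 + 1 / 2 = 1 + m / 2 := by ring
  have e2 : 2 * ((1 + m) / 2) = 1 + m := by ring
  have e3 : 1 - (1 + m) = -(m / 2) + -(m / 2) := by ring
  rw [e1, e2, e3, Real.rpow_add two_pos, Real.rpow_neg two_pos.le] at h2
  have h3 : (0 : ℝ) < 2 ^ (m / 2) := by positivity
  have h4 : 0 < √Real.pi := Real.sqrt_pos.2 Real.pi_pos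
  rw [c_eq_gamma_half hm, eq_div_iff (by positivity)]
  calc _ = (√Real.pi)⁻¹ * 2 ^ (m / 2) * 2 ^ (m / 2) *
        (Real.Gamma ((1 + m) / 2) * Real.Gamma (1 + m / 2)) := by ring
    _ = _ := by rw [h2]; field_simp

lemma continuousOn_phi_integrand {m : ℝ} (hm : 0 ≤ m) :
    ContinuousOn (fun y : ℝ ↦ y ^ m / (1 + y)) (Icc 0 2) := by
  refine ContinuousOn.div ?_ (by fun_prop) fun y hy ↦ by linarith [hy.1]
  exact (Real.continuous_rpow_const hm).continuousOn

/-- Since `y^(m+1)/(1+y) = y^m - y^m/(1+y)`; the last integrand is the one produced by the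
substitution in `integral_pos_part`. -/
lemma phi_eq_sub {m : ℝ} (hm : 0 ≤ m) :
    phi m = 2 ^ (m + 1) / (m + 1) - ∫ y in (0 : ℝ)..2, y ^ m / (1 + y) := by
  have h2 : uIcc (0 : ℝ) 2 = Icc 0 2 := uIcc_of_le two_pos.le
  have h1 : ∫ y in (0 : ℝ)..2, y ^ m = 2 ^ (m + 1) / (m + 1) := by
    rw [integral_rpow (Or.inl (by linarith)), Real.zero_rpow (by linarith), sub_zero]
  have hint : IntervalIntegrable (fun y : ℝ ↦ y ^ m / (1 + y)) volume 0 2 :=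
    ContinuousOn.intervalIntegrable (by rw [h2]; exact continuousOn_phi_integrand hm)
  rw [← h1, ← intervalIntegral.integral_sub
    ((Real.continuous_rpow_const hm).intervalIntegrable _ _)
    hint, phi]
  refine intervalIntegral.integral_congr fun y hy ↦ ?_
  rw [h2] at hy
  have hy1 : (1 + y) ≠ 0 := by linarith [hy.1]
  have e : y ^ (m + 1) = y ^ m * y := by
    rcases hy.1.eq_or_lt with h | h
    · rw [← h, Real.zero_rpow (by linarith), mul_zero]
    · rw [Real.rpow_add h, Real.rpow_one]
  rw [e]
  field_simp
  ring

lemma integral_pos_part {m : ℝ} (hm : 0 ≤ m) :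
    ∫ x in (0 : ℝ)..1, x ^ m * (1 - (3 - 2 * x) ^ (-(m + 1))) = phi m / 2 ^ (m + 1) := by
  have h01 : uIcc (0 : ℝ) 1 = Icc 0 1 := uIcc_of_le zero_le_one
  have hpos : ∀ x ∈ Icc (0 : ℝ) 1, 0 < 3 - 2 * x := fun x hx ↦ by linarith [hx.2]
  -- The substitution `y = 2x/(3-2x)` maps `[0,1]` onto `[0,2]`, with `1 + y = 3/(3-2x)`.
  have hsub := intervalIntegral.integral_comp_mul_deriv' (a := 0) (b := 1)
    (f := fun x : ℝ ↦ 2 * x / (3 - 2 * x)) (f' := fun x ↦ 6 / (3 - 2 * x) ^ 2)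
    (g := fun y ↦ y ^ m / (1 + y)) ?_ ?_ ?_
  rotate_left
  · intro x hx
    rw [h01] at hx
    have := hpos x hx
    have h1 : HasDerivAt (fun x : ℝ ↦ 2 * x) 2 x := by
      simpa using (hasDerivAt_id x).const_mul (2 : ℝ)
    refine (h1.div (h1.const_sub 3) this.ne').congr_deriv ?_
    congr 1
    ring
  · rw [h01]
    refine ContinuousOn.div (by fun_prop) (by fun_prop) fun x hx ↦ ?_
    have := hpos x hx
    positivity
  · refine (continuousOn_phi_integrand hm).mono ?_
    rintro _ ⟨x, hx, rfl⟩
    rw [h01] at hx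
    have := hpos x hx
    exact ⟨div_nonneg (by linarith [hx.1]) this.le, (div_le_iff₀ this).2 (by linarith [hx.2])⟩
  have he : ∀ x ∈ Icc (0 : ℝ) 1,
      ((fun y ↦ y ^ m / (1 + y)) ∘ fun x : ℝ ↦ 2 * x / (3 - 2 * x)) x * (6 / (3 - 2 * x) ^ 2) =
      2 ^ (m + 1) * (x ^ m * (3 - 2 * x) ^ (-(m + 1))) := fun x hx ↦ by
    have hp := hpos x hx
    have h1 : 1 + 2 * x / (3 - 2 * x) = 3 / (3 - 2 * x) := by field_simp; ring
    simp only [Function.comp_apply]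
    rw [h1, Real.div_rpow (by linarith [hx.1]) hp.le, Real.mul_rpow two_pos.le hx.1,
      Real.rpow_neg hp.le, Real.rpow_add hp, Real.rpow_add two_pos, Real.rpow_one, Real.rpow_one]
    field_simp
    ring
  rw [intervalIntegral.integral_congr (g := fun x ↦
    2 ^ (m + 1) * (x ^ m * (3 - 2 * x) ^ (-(m + 1)))) (fun x hx ↦ he x (h01 ▸ hx)),
    intervalIntegral.integral_const_mul] at hsub
  norm_num at hsub
  have hc2 : ContinuousOn (fun x : ℝ ↦ x ^ m * (3 - 2 * x) ^ (-(m + 1))) (uIcc 0 1) := by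
    rw [h01]
    refine (Real.continuous_rpow_const hm).continuousOn.mul ?_
    exact ContinuousOn.rpow_const (by fun_prop) fun x hx ↦ Or.inl (hpos x hx).ne'
  simp only [mul_sub, mul_one]
  rw [intervalIntegral.integral_sub ((Real.continuous_rpow_const hm).intervalIntegrable _ _)
    hc2.intervalIntegrable, integral_rpow (Or.inl (by linarith)), Real.zero_rpow (by linarith),
    Real.one_rpow, phi_eq_sub hm, ← hsub]
  have : (0 : ℝ) < 2 ^ (m + 1) := by positivity
  field_simp
  ring_nf

/-- On `(0,1)` the first base `|x| + (1 - x)` is `1`. The convention `0^0 = 0` removes `x ≤ 0` even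
when `m = 0`. -/
lemma lintegral_pos_part {m : ℝ} (hm : 0 ≤ m) :
    ∫⁻ x in Iio 1, ENNReal.ofReal (pow₀ (max x 0) m) * ENNReal.ofReal
        (Real.Gamma (m + 1) * (|x| + (1 - x)) ^ (-(m + 1)) -
          Real.Gamma (m + 1) * (3 - 2 * x) ^ (-(m + 1))) =
      ENNReal.ofReal (Real.Gamma (m + 1) * (phi m / 2 ^ (m + 1))) := by
  have hΓ := Real.Gamma_pos_of_pos (s := m + 1) (by linarith)
  have hpos : ∀ x ∈ Icc (0 : ℝ) 1, 0 < 3 - 2 * x := fun x hx ↦ by linarith [hx.2]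
  have hle : ∀ x ∈ Ioo (0 : ℝ) 1, 0 ≤ 1 - (3 - 2 * x) ^ (-(m + 1)) := fun x hx ↦
    sub_nonneg.2 (Real.rpow_le_one_of_one_le_of_nonpos (by linarith [hx.2]) (by linarith))
  have hcont : ContinuousOn
      (fun x : ℝ ↦ Real.Gamma (m + 1) * (x ^ m * (1 - (3 - 2 * x) ^ (-(m + 1))))) (Icc 0 1) := by
    refine continuousOn_const.mul ((Real.continuous_rpow_const hm).continuousOn.mul
      (continuousOn_const.sub ?_))
    exact ContinuousOn.rpow_const (by fun_prop) fun x hx ↦ Or.inl (hpos x hx).ne'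
  rw [← integral_pos_part hm, ← intervalIntegral.integral_const_mul,
    intervalIntegral.integral_of_le zero_le_one, ← setIntegral_congr_set Ioo_ae_eq_Ioc,
    ofReal_integral_eq_lintegral_ofReal
      ((hcont.integrableOn_compact isCompact_Icc).mono_set Ioo_subset_Icc_self)
      ((ae_restrict_iff' measurableSet_Ioo).2 (ae_of_all _ fun x hx ↦
        mul_nonneg hΓ.le (mul_nonneg (Real.rpow_nonneg hx.1.le _) (hle x hx)))),
    ← Ioi_inter_Iio, ← Measure.restrict_restrict measurableSet_Ioi,
    ← lintegral_indicator measurableSet_Ioi]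
  refine setLIntegral_congr_fun measurableSet_Iio fun x hx ↦ ?_
  rcases le_or_gt x 0 with h | h
  · simp [indicator, h.not_gt, pow₀, h]
  · rw [indicator_of_mem (by exact h), max_eq_left h.le, pow₀, if_neg h.ne', abs_of_pos h,
      add_sub_cancel, Real.one_rpow, ← ENNReal.ofReal_mul (Real.rpow_nonneg h.le _)]
    congr 1
    ring

/-- An antiderivative is `(y/(a+2y))^(m+1)/a`, and `y/(a+2y)` runs from `0` to `1/2`. -/
lemma lintegral_Ioi_rpow_mul_rpow {m a : ℝ} (hm : 0 ≤ m) (ha : 0 < a) :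
    ∫⁻ y in Ioi (0 : ℝ), ENNReal.ofReal ((m + 1) * y ^ m * (a + 2 * y) ^ (-(m + 2))) =
      ENNReal.ofReal ((1 / 2) ^ (m + 1) * a⁻¹) := by
  have hratio : Tendsto (fun y : ℝ ↦ y / (a + 2 * y)) atTop (𝓝 (1 / 2)) := by
    have h1 : Tendsto (fun y : ℝ ↦ (a * y⁻¹ + 2)⁻¹) atTop (𝓝 (1 / 2)) := by
      have := ((tendsto_inv_atTop_zero (𝕜 := ℝ)).const_mul a).add_const 2
      rw [mul_zero, zero_add] at this
      simpa using this.inv₀ two_ne_zero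
    refine h1.congr' ?_
    filter_upwards [eventually_gt_atTop 0] with y hy
    field_simp
  have h := lintegral_Ioi_of_hasDerivAt (g := fun y ↦ (y / (a + 2 * y)) ^ (m + 1) * a⁻¹)
    (g' := fun y ↦ (m + 1) * y ^ m * (a + 2 * y) ^ (-(m + 2))) (c := 0) (a := 0)
    (b := (1 / 2) ^ (m + 1) * a⁻¹) (fun y hy ↦ ?_) (fun y hy ↦ ?_) ?_ ?_
  · rw [h, sub_zero]
  · have hy0 : (0 : ℝ) < y := hy
    have hp : 0 < a + 2 * y := by positivity
    have h1 : HasDerivAt (fun y : ℝ ↦ a + 2 * y) 2 y := by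
      simpa using ((hasDerivAt_id y).const_mul (2 : ℝ)).const_add a
    refine ((((hasDerivAt_id y).div h1 hp.ne').rpow_const (p := m + 1)
      (Or.inl ?_)).mul_const a⁻¹).congr_deriv ?_
    · exact (div_pos hy0 hp).ne'
    · simp only [id, Pi.div_apply]
      rw [add_sub_cancel_right, Real.div_rpow hy0.le hp.le, Real.rpow_neg hp.le,
        Real.rpow_add hp, Real.rpow_two]
      field_simp
      ring
  · have hy0 : (0 : ℝ) < y := hy
    positivity
  · have hc : ContinuousAt (fun y : ℝ ↦ (y / (a + 2 * y)) ^ (m + 1) * a⁻¹) 0 := by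
      refine ContinuousAt.mul (ContinuousAt.rpow_const ?_ (Or.inr (by linarith))) continuousAt_const
      exact ContinuousAt.div (by fun_prop) (by fun_prop) (by simpa using ha.ne')
    have := hc.tendsto.mono_left (nhdsWithin_le_nhds (s := Ioi 0))
    simpa [Real.zero_rpow (by linarith : m + 1 ≠ 0)] using this
  · exact (hratio.rpow_const (Or.inl (by norm_num))).mul_const _

lemma lintegral_Ioc_rpow {m y : ℝ} (hm : 0 ≤ m) (hy : 0 < y) :
    ∫⁻ a in Ioc (1 : ℝ) 3, ENNReal.ofReal ((m + 1) * y ^ m * (a + 2 * y) ^ (-(m + 2))) =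
      ENNReal.ofReal (y ^ m * ((1 + 2 * y) ^ (-(m + 1)) - (3 + 2 * y) ^ (-(m + 1)))) := by
  have h13 : uIcc (1 : ℝ) 3 = Icc 1 3 := uIcc_of_le (by norm_num)
  have hp : ∀ a ∈ Icc (1 : ℝ) 3, 0 < a + 2 * y := fun a ha ↦ by linarith [ha.1]
  have hcont : ContinuousOn (fun a : ℝ ↦ (m + 1) * y ^ m * (a + 2 * y) ^ (-(m + 2))) (Icc 1 3) :=
    continuousOn_const.mul (ContinuousOn.rpow_const (by fun_prop) fun a ha ↦ Or.inl (hp a ha).ne')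
  have hint := intervalIntegral.integral_eq_sub_of_hasDerivAt (a := 1) (b := 3)
    (f := fun a ↦ -(y ^ m * (a + 2 * y) ^ (-(m + 1))))
    (f' := fun a ↦ (m + 1) * y ^ m * (a + 2 * y) ^ (-(m + 2))) (fun a ha ↦ ?_)
    (by rw [← h13] at hcont; exact hcont.intervalIntegrable)
  · rw [← ofReal_integral_eq_lintegral_ofReal
      ((hcont.integrableOn_compact isCompact_Icc).mono_set Ioc_subset_Icc_self)
      ((ae_restrict_iff' measurableSet_Ioc).2 (ae_of_all _ fun a ha ↦ ?_)),
      ← intervalIntegral.integral_of_le (by norm_num), hint]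
    · congr 1; ring
    · have := hp a (Ioc_subset_Icc_self ha)
      positivity
  · rw [h13] at ha
    have h1 : HasDerivAt (fun a : ℝ ↦ a + 2 * y) 1 a := (hasDerivAt_id a).add_const _
    refine ((h1.rpow_const (p := -(m + 1)) (Or.inl (hp a ha).ne')).const_mul (y ^ m)).neg.congr_deriv
      ?_
    have : -(m + 1) - 1 = -(m + 2) := by ring
    rw [this]
    ring

/-- Frullani's trick: each power alone gives a divergent integral, so the difference is written as
an integral over `a` in `(1, 3]`. Integrating in `y` first leaves `2^(-(m+1)) ∫₁³ da/a`, whence the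
`log 3`. -/
lemma lintegral_neg_part {m : ℝ} (hm : 0 ≤ m) :
    ∫⁻ x in Iio 1, ENNReal.ofReal (pow₀ (max (-x) 0) m) * ENNReal.ofReal
        (Real.Gamma (m + 1) * (|x| + (1 - x)) ^ (-(m + 1)) -
          Real.Gamma (m + 1) * (3 - 2 * x) ^ (-(m + 1))) =
      ENNReal.ofReal (Real.Gamma (m + 1) * (Real.log 3 / 2 ^ (m + 1))) := by
  have hΓ := Real.Gamma_pos_of_pos (s := m + 1) (by linarith)
  let G : ℝ → ℝ≥0∞ := fun y ↦ ENNReal.ofReal (Real.Gamma (m + 1)) *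
    ENNReal.ofReal (y ^ m * ((1 + 2 * y) ^ (-(m + 1)) - (3 + 2 * y) ^ (-(m + 1))))
  calc _ = ∫⁻ x, (Ioi 0).indicator G (-x) := by
        rw [← lintegral_indicator measurableSet_Iio]
        refine lintegral_congr fun x ↦ ?_
        rcases le_or_gt 0 x with h | h
        · simp [indicator, h.not_gt, pow₀, h]
        · have hx : 0 < -x := neg_pos.2 h
          rw [indicator_of_mem (by exact h.trans one_pos), indicator_of_mem (by exact hx),
            max_eq_left hx.le, pow₀, if_neg hx.ne', abs_of_neg h,
            ← ENNReal.ofReal_mul (Real.rpow_nonneg hx.le _)]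
          refine Eq.trans ?_ (ENNReal.ofReal_mul hΓ.le)
          have e1 : -x + (1 - x) = 1 + 2 * -x := by ring
          have e2 : 3 - 2 * x = 3 + 2 * -x := by ring
          rw [e1, e2]
          congr 1
          ring
    _ = ∫⁻ y in Ioi (0 : ℝ), G y := by
        rw [lintegral_neg_eq_self (μ := volume) ((Ioi 0).indicator G),
          lintegral_indicator measurableSet_Ioi]
    _ = ENNReal.ofReal (Real.Gamma (m + 1)) * ∫⁻ y in Ioi (0 : ℝ), (∫⁻ a in Ioc (1 : ℝ) 3,
        ENNReal.ofReal ((m + 1) * y ^ m * (a + 2 * y) ^ (-(m + 2)))) := by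
        rw [← lintegral_const_mul' _ _ ENNReal.ofReal_ne_top]
        refine setLIntegral_congr_fun measurableSet_Ioi fun y hy ↦ ?_
        rw [lintegral_Ioc_rpow hm hy]
    _ = ENNReal.ofReal (Real.Gamma (m + 1)) * ∫⁻ a in Ioc (1 : ℝ) 3, (∫⁻ y in Ioi (0 : ℝ),
        ENNReal.ofReal ((m + 1) * y ^ m * (a + 2 * y) ^ (-(m + 2)))) := by
        rw [lintegral_lintegral_swap (Measurable.aemeasurable (by fun_prop))]
    _ = ENNReal.ofReal (Real.Gamma (m + 1)) * ∫⁻ a in Ioc (1 : ℝ) 3,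
        ENNReal.ofReal ((1 / 2) ^ (m + 1) * a⁻¹) := by
        congr 1
        refine setLIntegral_congr_fun measurableSet_Ioc fun a ha ↦ ?_
        exact lintegral_Ioi_rpow_mul_rpow hm (by linarith [ha.1])
    _ = _ := by
        have hcont : ContinuousOn (fun a : ℝ ↦ (1 / 2) ^ (m + 1) * a⁻¹) (Icc 1 3) :=
          continuousOn_const.mul (continuousOn_inv₀.mono fun a ha ↦ by
            have : 0 < a := by linarith [ha.1]
            exact this.ne')
        rw [← ofReal_integral_eq_lintegral_ofReal
          ((hcont.integrableOn_compact isCompact_Icc).mono_set Ioc_subset_Icc_self)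
          ((ae_restrict_iff' measurableSet_Ioc).2 (ae_of_all _ fun a ha ↦ ?_)),
          ← intervalIntegral.integral_of_le (by norm_num), intervalIntegral.integral_const_mul,
          integral_inv_of_pos one_pos (by norm_num), ← ENNReal.ofReal_mul hΓ.le,
          one_div, Real.inv_rpow two_pos.le, div_one]
        · congr 1; ring
        · have : 0 < a := by linarith [ha.1]
          positivity

end

/-! ### Convexity and monotonicity of `phi`. -/

section

lemma intervalIntegrable_phi_integrand {m : ℝ} (hm : -2 < m) :
    IntervalIntegrable (fun y : ℝ ↦ y ^ (m + 1) / (1 + y)) volume 0 2 := by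
  simp only [div_eq_mul_inv]
  refine (intervalIntegral.intervalIntegrable_rpow' (by linarith)).mul_continuousOn ?_
  rw [uIcc_of_le two_pos.le]
  exact ContinuousOn.inv₀ (by fun_prop) fun y hy ↦ by linarith [hy.1]

/-- For fixed `y > 0` the map `m ↦ y^(m+1)` is convex, which is weighted AM-GM; convexity survives
integration. -/
lemma convexOn_phi : ConvexOn ℝ (Ioi (-2)) phi := by
  refine ⟨convex_Ioi _, fun p hp q hq a b ha hb hab ↦ ?_⟩
  have hp' : -2 < p := hp
  have hq' : -2 < q := hq
  have hpq : -2 < a * p + b * q := by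
    have := (convex_Ioi (-2 : ℝ)) hp hq ha hb hab
    simpa using this
  simp only [smul_eq_mul, phi]
  rw [← intervalIntegral.integral_const_mul, ← intervalIntegral.integral_const_mul,
    ← intervalIntegral.integral_add ((intervalIntegrable_phi_integrand hp').const_mul a)
      ((intervalIntegrable_phi_integrand hq').const_mul b)]
  refine intervalIntegral.integral_mono_on_of_le_Ioo two_pos.le
    (intervalIntegrable_phi_integrand hpq)
    (((intervalIntegrable_phi_integrand hp').const_mul a).add
      ((intervalIntegrable_phi_integrand hq').const_mul b)) fun y hy ↦ ?_
  have hy0 : 0 < y := hy.1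
  have h := Real.geom_mean_le_arith_mean2_weighted ha hb (Real.rpow_nonneg hy0.le (p + 1))
    (Real.rpow_nonneg hy0.le (q + 1)) hab
  rw [← Real.rpow_mul hy0.le, ← Real.rpow_mul hy0.le, ← Real.rpow_add hy0] at h
  have e : (p + 1) * a + (q + 1) * b = a * p + b * q + 1 := by linear_combination hab
  rw [e] at h
  rw [mul_div_assoc', mul_div_assoc', ← add_div]
  gcongr

lemma hasDerivAt_phi_zero :
    HasDerivAt phi (∫ y in (0 : ℝ)..2, y * Real.log y / (1 + y)) 0 := by
  have h := intervalIntegral.hasDerivAt_integral_of_dominated_loc_of_deriv_le (μ := volume)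
    -- For `|m| < 1/2`: on `(0,1]`, `|y^(m+1) log y| < 1/(m+1) < 2`; on `[1,2]`, `y^(m+1) ≤ y² ≤ 4`
    -- and `log y ≤ 1`.
    (a := 0) (b := 2) (bound := fun _ ↦ (4 : ℝ))
    (F := fun m y ↦ y ^ (m + 1) / (1 + y)) (F' := fun m y ↦ y ^ (m + 1) * Real.log y / (1 + y))
    (x₀ := (0 : ℝ)) (s := Ioo (-(1 / 2)) (1 / 2)) (Ioo_mem_nhds (by norm_num) (by norm_num))
    (Eventually.of_forall fun m ↦ ?_) (intervalIntegrable_phi_integrand (by norm_num)) ?_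
    (ae_of_all _ fun y hy m hm ↦ ?_) (by simp) (ae_of_all _ fun y hy m _ ↦ ?_)
  · have := h.2
    simp only [zero_add, Real.rpow_one] at this
    exact this
  · exact Measurable.aestronglyMeasurable (by fun_prop)
  · exact Measurable.aestronglyMeasurable (by fun_prop)
  · rw [uIoc_of_le two_pos.le] at hy
    have hy0 : 0 < y := hy.1
    rw [Real.norm_eq_abs, abs_div, abs_of_pos (by linarith : 0 < 1 + y)]
    refine (div_le_self (abs_nonneg _) (by linarith)).trans ?_
    rcases le_or_gt y 1 with h1 | h1
    · have := Real.abs_log_mul_self_rpow_lt y (m + 1) hy0 h1 (by linarith [hm.1])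
      rw [mul_comm]
      refine this.le.trans ?_
      rw [div_le_iff₀ (by linarith [hm.1])]
      linarith [hm.1]
    · have hl0 : 0 ≤ Real.log y := Real.log_nonneg h1.le
      have hl1 : Real.log y ≤ 1 := (Real.log_le_sub_one_of_pos hy0).trans (by linarith [hy.2])
      have hr : y ^ (m + 1) ≤ 4 := by
        calc y ^ (m + 1) ≤ y ^ (2 : ℝ) :=
              Real.rpow_le_rpow_of_exponent_le h1.le (by linarith [hm.2])
          _ ≤ 4 := by rw [Real.rpow_two]; nlinarith [hy.2]
      rw [abs_of_nonneg (mul_nonneg (Real.rpow_nonneg hy0.le _) hl0)]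
      nlinarith [Real.rpow_nonneg hy0.le (m + 1)]
  · rw [uIoc_of_le two_pos.le] at hy
    have h1 : HasDerivAt (fun m : ℝ ↦ m + 1) 1 m := (hasDerivAt_id m).add_const 1
    refine ((h1.const_rpow hy.1).div_const (1 + y)).congr_deriv ?_
    ring

lemma continuous_pow_mul_log (n : ℕ) : Continuous fun y : ℝ ↦ y ^ (n + 1) * Real.log y := by
  have : (fun y : ℝ ↦ y ^ (n + 1) * Real.log y) = fun y ↦ y ^ n * (y * Real.log y) := by
    ext y; ring
  rw [this]
  exact (continuous_pow n).mul Real.continuous_mul_log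

lemma integral_pow_mul_log (n : ℕ) :
    ∫ y in (0 : ℝ)..2, y ^ (n + 1) * Real.log y =
      2 ^ (n + 2) / (n + 2) * (Real.log 2 - 1 / (n + 2)) := by
  have hn : ((n : ℝ) + 2) ≠ 0 := by positivity
  rw [intervalIntegral.integral_eq_sub_of_hasDerivAt_of_le two_pos.le
    (f := fun y ↦ (y ^ (n + 1 + 1) * Real.log y) / (n + 2) - y ^ (n + 2) / (n + 2) ^ 2)
    (((continuous_pow_mul_log (n + 1)).div_const _).sub (by fun_prop)).continuousOn
    (fun y hy ↦ ?_) ((continuous_pow_mul_log n).intervalIntegrable _ _)]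
  · simp
    field_simp
  · have hy0 : y ≠ 0 := hy.1.ne'
    refine ((((hasDerivAt_pow (n + 1 + 1) y).mul (Real.hasDerivAt_log hy0)).div_const _).sub
      ((hasDerivAt_pow (n + 2) y).div_const _)).congr_deriv ?_
    push_cast
    field_simp
    ring

/-- The quadratic `1 - 2y/3 + y²/6` interpolates `1/(1+y)` at `0, 1, 2`. On `(0,2)` the error has
the sign of `y - 1`, as does `log y`, so the replacement can only lower the integral. What remains
is `(8/9) log 2 - 31/54 > 0`. -/
lemma deriv_phi_zero_pos : 0 < ∫ y in (0 : ℝ)..2, y * Real.log y / (1 + y) := by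
  have hint : IntervalIntegrable (fun y : ℝ ↦ y * Real.log y / (1 + y)) volume 0 2 := by
    refine ContinuousOn.intervalIntegrable ?_
    rw [uIcc_of_le two_pos.le]
    exact Real.continuous_mul_log.continuousOn.div (by fun_prop) fun y hy ↦ by linarith [hy.1]
  have i1 := (continuous_pow_mul_log 0).intervalIntegrable (μ := volume) 0 2
  have i2 := (continuous_pow_mul_log 1).intervalIntegrable (μ := volume) 0 2
  have i3 := (continuous_pow_mul_log 2).intervalIntegrable (μ := volume) 0 2
  have hmono := intervalIntegral.integral_mono_on_of_le_Ioo two_pos.le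
    ((i1.sub (i2.const_mul (2 / 3))).add (i3.const_mul (1 / 6))) hint fun y hy ↦ ?_
  · refine lt_of_lt_of_le ?_ hmono
    rw [intervalIntegral.integral_add (i1.sub (i2.const_mul (2 / 3))) (i3.const_mul (1 / 6)),
      intervalIntegral.integral_sub i1 (i2.const_mul (2 / 3)),
      intervalIntegral.integral_const_mul, intervalIntegral.integral_const_mul,
      integral_pow_mul_log, integral_pow_mul_log, integral_pow_mul_log]
    have := Real.log_two_gt_d9
    norm_num
    linarith
  · have hy0 : 0 < y := hy.1
    have hy2 : y < 2 := hy.2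
    have hsign : 0 ≤ (y - 1) * Real.log y := by
      rcases le_total y 1 with h | h
      · exact mul_nonneg_of_nonpos_of_nonpos (by linarith) (Real.log_nonpos hy0.le h)
      · exact mul_nonneg (by linarith) (Real.log_nonneg h)
    have hdiff : y * Real.log y / (1 + y) - (y ^ (0 + 1) * Real.log y -
        2 / 3 * (y ^ (1 + 1) * Real.log y) + 1 / 6 * (y ^ (2 + 1) * Real.log y)) =
        ((y - 1) * Real.log y) * (y ^ 2 * (2 - y)) / (6 * (1 + y)) := by
      field_simp
      ring
    rw [← sub_nonneg, hdiff]
    have : 0 ≤ y ^ 2 * (2 - y) := mul_nonneg (sq_nonneg _) (by linarith)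
    exact div_nonneg (mul_nonneg hsign this) (by linarith)

/-- Chord slopes of a convex function increase, and those starting at `0` are at least `φ'(0) > 0`.
-/
lemma strictMonoOn_phi : StrictMonoOn phi (Ici 0) := by
  have hmem : ∀ x : ℝ, 0 ≤ x → x ∈ Ioi (-2 : ℝ) := fun x hx ↦ by
    simp only [mem_Ioi]; linarith
  have h0 : ∀ x : ℝ, 0 < x → 0 < slope phi 0 x := fun x hx ↦
    deriv_phi_zero_pos.trans_le (convexOn_phi.le_slope_of_hasDerivAt (hmem 0 le_rfl)
      (hmem x hx.le) hx hasDerivAt_phi_zero)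
  intro a ha b hb hab
  have ha0 : (0 : ℝ) ≤ a := ha
  have hslope : 0 < slope phi a b := by
    rcases ha0.eq_or_lt with h | h
    · rw [← h] at hab ⊢
      exact h0 b hab
    · have := convexOn_phi.slope_mono_adjacent (hmem 0 le_rfl) (hmem b hb) h hab
      have h1 := h0 a h
      rw [slope_def_field] at h1 ⊢
      exact h1.trans_le this
  rw [slope_def_field] at hslope
  have := (div_pos_iff_of_pos_right (sub_pos.2 hab)).1 hslope
  linarith

/-- The integrand is `y - 1 + 1/(1+y)`, and `y - 1` has integral zero over `[0,2]`. This makes `m =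
1` the point where the signed expectation vanishes. -/
lemma phi_one : phi 1 = Real.log 3 := by
  have h : ∀ y ∈ uIcc (0 : ℝ) 2, HasDerivAt (fun y ↦ y ^ 2 / 2 - y + Real.log (1 + y))
      (y ^ ((1 : ℝ) + 1) / (1 + y)) y := fun y hy ↦ by
    rw [uIcc_of_le two_pos.le] at hy
    have hy1 : 1 + y ≠ 0 := by linarith [hy.1]
    have e : y ^ ((1 : ℝ) + 1) = y ^ 2 := by rw [one_add_one_eq_two, Real.rpow_two]
    have h1 : HasDerivAt (fun y : ℝ ↦ 1 + y) 1 y := (hasDerivAt_id y).const_add 1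
    refine ((((hasDerivAt_pow 2 y).div_const 2).sub (hasDerivAt_id y)).add
      (h1.log hy1)).congr_deriv ?_
    rw [e]
    field_simp
    ring
  rw [phi, intervalIntegral.integral_eq_sub_of_hasDerivAt h
    (intervalIntegrable_phi_integrand (by norm_num))]
  norm_num

end

/-! ### Passage to the functionals, and reduction to continuous versions. -/

section

variable {Ω : Type*} {B : ℝ≥0 → Ω → ℝ}

lemma measurable_pow₀ (m : ℝ) : Measurable fun x ↦ pow₀ x m := by
  unfold pow₀
  exact Measurable.ite (measurableSet_singleton 0) measurable_const (by fun_prop)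

lemma pow₀_nonneg {x : ℝ} (hx : 0 ≤ x) (m : ℝ) : 0 ≤ pow₀ x m := by
  unfold pow₀
  split_ifs
  · exact le_rfl
  · exact Real.rpow_nonneg hx m

lemma pow₀_le_rpow {x R m : ℝ} (hx : 0 ≤ x) (hxR : x ≤ R) (hm : 0 ≤ m) : pow₀ x m ≤ R ^ m := by
  unfold pow₀
  split_ifs
  · exact Real.rpow_nonneg (hx.trans hxR) m
  · exact Real.rpow_le_rpow hx hxR hm

lemma abs_rpow_mul_sign (x m : ℝ) :
    |x| ^ m * Real.sign x = pow₀ (max x 0) m - pow₀ (max (-x) 0) m := by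
  rcases lt_trichotomy x 0 with h | h | h
  · have hx : 0 < -x := neg_pos.2 h
    rw [Real.sign_of_neg h, abs_of_neg h, max_eq_right h.le, max_eq_left hx.le]
    simp [pow₀, h.ne]
  · simp [h, pow₀]
  · have hx : -x ≤ 0 := (neg_neg_of_pos h).le
    rw [Real.sign_of_pos h, abs_of_pos h, max_eq_left h.le, max_eq_right hx]
    simp [pow₀, h.ne']

/-- A bounded measurable function of a continuous path is integrable over bounded intervals. -/
lemma integrableOn_comp_path {ω : Ω} (hc : Continuous (B · ω)) {g : ℝ → ℝ} (hg : Measurable g)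
    (hbd : ∀ R, ∃ C, ∀ x, |x| ≤ R → |g x| ≤ C) (t : ℝ) :
    IntegrableOn (fun s : ℝ ↦ g (B s.toNNReal ω)) (Ioc 0 t) := by
  have hcont : Continuous fun s : ℝ ↦ B s.toNNReal ω := hc.comp continuous_real_toNNReal
  obtain ⟨R, hR⟩ := (isCompact_Icc (a := (0 : ℝ)) (b := t)).exists_bound_of_continuousOn
    hcont.continuousOn
  obtain ⟨C, hC⟩ := hbd R
  refine IntegrableOn.of_bound measure_Ioc_lt_top
    (hg.comp hcont.measurable).aestronglyMeasurable C ?_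
  exact (ae_restrict_iff' measurableSet_Ioc).2 (ae_of_all _ fun s hs ↦
    hC _ (hR s (Ioc_subset_Icc_self hs)))

lemma bounded_pow₀_pos {m : ℝ} (hm : 0 ≤ m) (R : ℝ) :
    ∃ C, ∀ x, |x| ≤ R → |pow₀ (max x 0) m| ≤ C := by
  refine ⟨R ^ m, fun x hx ↦ ?_⟩
  rw [abs_of_nonneg (pow₀_nonneg (le_max_right _ _) m)]
  exact pow₀_le_rpow (le_max_right _ _)
    (max_le ((le_abs_self x).trans hx) ((abs_nonneg x).trans hx)) hm

lemma bounded_pow₀_neg {m : ℝ} (hm : 0 ≤ m) (R : ℝ) :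
    ∃ C, ∀ x, |x| ≤ R → |pow₀ (max (-x) 0) m| ≤ C := by
  obtain ⟨C, hC⟩ := bounded_pow₀_pos hm R
  exact ⟨C, fun x hx ↦ hC (-x) (by rwa [abs_neg])⟩

lemma A_eq_sub {ω : Ω} (hc : Continuous (B · ω)) {m : ℝ} (hm : 0 ≤ m) :
    A B m ω = Apos B m ω - Aneg B m ω := by
  have hint := fun {g : ℝ → ℝ} (hg : Measurable g) hbd ↦
    (intervalIntegrable_iff_integrableOn_Ioc_of_le (μ := volume) (T₁_nonneg B ω)).2
      (integrableOn_comp_path hc hg hbd (T₁ B ω))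
  have h1 := hint (g := fun x ↦ pow₀ (max x 0) m)
    ((measurable_pow₀ m).comp (measurable_id.max measurable_const)) (bounded_pow₀_pos hm)
  have h2 := hint (g := fun x ↦ pow₀ (max (-x) 0) m)
    ((measurable_pow₀ m).comp (measurable_neg.max measurable_const)) (bounded_pow₀_neg hm)
  rw [A, Apos, Aneg, ← mul_sub, ← intervalIntegral.integral_sub h1 h2]
  simp only [abs_rpow_mul_sign]

lemma hit_congr {B' : ℝ≥0 → Ω → ℝ} {ω : Ω} (h : ∀ t, B' t ω = B t ω) : hit B' ω = hit B ω := by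
  -- The hitting time at `ω` depends only on the path of `ω`, so each path may be viewed as a
  -- process on a one-point space.
  change hittingAfter (fun t (_ : Unit) ↦ B' t ω) {1} 0 () =
    hittingAfter (fun t (_ : Unit) ↦ B t ω) {1} 0 ()
  simp only [h]

lemma T₁_congr {B' : ℝ≥0 → Ω → ℝ} {ω : Ω} (h : ∀ t, B' t ω = B t ω) : T₁ B' ω = T₁ B ω := by
  rw [T₁, hit_congr h, T₁]

variable [MeasurableSpace Ω] {P : Measure Ω}

/-- The expectation of the scaled additive functional associated with a nonnegative function. -/
lemma integral_scaled_functional (hB : IsPreBrownianReal B P) (hm : ∀ t, Measurable (B t))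
    (hc : ∀ ω, Continuous (B · ω)) (h0 : ∀ ω, B 0 ω = 0) {g : ℝ → ℝ} (hg : Measurable g)
    (hg0 : ∀ x, 0 ≤ g x) (hbd : ∀ R, ∃ C, ∀ x, |x| ≤ R → |g x| ≤ C) {m J : ℝ} (hm0 : 0 ≤ m)
    (hJ0 : 0 ≤ J)
    (hJ : ∫⁻ x in Iio 1, ENNReal.ofReal (g x) * ENNReal.ofReal
        (Real.Gamma (m + 1) * (|x| + (1 - x)) ^ (-(m + 1)) -
          Real.Gamma (m + 1) * (3 - 2 * x) ^ (-(m + 1))) =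
      ENNReal.ofReal (Real.Gamma (m + 1) * J)) :
    Integrable (fun ω ↦ 1 / T₁ B ω ^ (1 + m / 2) *
        ∫ s in (0 : ℝ)..T₁ B ω, g (B s.toNNReal ω)) P ∧
      ∫ ω, 1 / T₁ B ω ^ (1 + m / 2) * (∫ s in (0 : ℝ)..T₁ B ω, g (B s.toNNReal ω)) ∂P =
        c m * J := by
  have hT := measurable_T₁ hm hc h0
  have hpath := measurable_uncurry_path hm hc
  set S : Ω → ℝ := fun ω ↦ 1 / T₁ B ω ^ (1 + m / 2) *
    ∫ s in (0 : ℝ)..T₁ B ω, g (B s.toNNReal ω) with hS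
  have hS0 : ∀ ω, 0 ≤ S ω := fun ω ↦ mul_nonneg
    (one_div_nonneg.2 (Real.rpow_nonneg (T₁_nonneg B ω) _))
    (intervalIntegral.integral_nonneg (T₁_nonneg B ω) fun s _ ↦ hg0 _)
  have hmeas : Measurable S := by
    refine Measurable.mul (by fun_prop) ?_
    have h1 : ∀ ω, ∫ s in (0 : ℝ)..T₁ B ω, g (B s.toNNReal ω) =
        ∫ s, {q : Ω × ℝ | 0 < q.2 ∧ q.2 ≤ T₁ B q.1}.indicator
          (fun q ↦ g (B q.2.toNNReal q.1)) (ω, s) := fun ω ↦ by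
      rw [intervalIntegral.integral_of_le (T₁_nonneg B ω), ← integral_indicator measurableSet_Ioc]
      rfl
    simp only [h1]
    refine (StronglyMeasurable.integral_prod_right' (Measurable.stronglyMeasurable ?_)).measurable
    refine (hg.comp hpath).indicator ?_
    exact (measurableSet_lt measurable_const measurable_snd).inter
      (measurableSet_le measurable_snd (hT.comp measurable_fst))
  -- The constant of the superposition of exponentials; by duplication `Γ(m+1)/κ` is the Gaussian
  -- moment `c m`.
  set κ : ℝ := 2 ^ (m / 2) * Real.Gamma (1 + m / 2) with hκ
  have hκ0 : 0 < κ := mul_pos (by positivity) (Real.Gamma_pos_of_pos (by linarith))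
  have hSω : ∀ ω, ENNReal.ofReal κ * ENNReal.ofReal (S ω) =
      ENNReal.ofReal (κ * T₁ B ω ^ (-(1 + m / 2))) *
        ∫⁻ s in Ioo 0 (T₁ B ω), ENNReal.ofReal (g (B s.toNNReal ω)) := fun ω ↦ by
    have hTω := T₁_nonneg B ω
    rw [hS]
    simp only
    rw [one_div, ← Real.rpow_neg hTω, ENNReal.ofReal_mul (Real.rpow_nonneg hTω _),
      ENNReal.ofReal_mul hκ0.le, mul_assoc, intervalIntegral.integral_of_le hTω,
      ofReal_integral_eq_lintegral_ofReal (integrableOn_comp_path (hc ω) hg hbd _)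
        (ae_of_all _ fun s ↦ hg0 _), setLIntegral_congr Ioo_ae_eq_Ioc]
  have hlint : ∫⁻ ω, ENNReal.ofReal (S ω) ∂P = ENNReal.ofReal (c m * J) := by
    have h := lintegral_scaled_functional hB hm hc h0 hg.ennreal_ofReal hm0
    rw [hJ, ← hκ] at h
    simp only [← hSω] at h
    rw [lintegral_const_mul' _ _ ENNReal.ofReal_ne_top] at h
    have h2 : Real.Gamma (m + 1) * J = κ * (c m * J) := by
      rw [c_eq_gamma_div hm0, ← hκ, add_comm m 1]
      field_simp
    rw [h2, ENNReal.ofReal_mul hκ0.le] at h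
    exact (ENNReal.mul_right_inj (ENNReal.ofReal_pos.2 hκ0).ne' ENNReal.ofReal_ne_top).1 h
  refine ⟨⟨hmeas.aestronglyMeasurable, ?_⟩, ?_⟩
  · rw [hasFiniteIntegral_iff_ofReal (ae_of_all _ hS0), hlint]
    exact ENNReal.ofReal_lt_top
  · rw [integral_eq_lintegral_of_nonneg_ae (ae_of_all _ hS0) hmeas.aestronglyMeasurable, hlint,
      ENNReal.toReal_ofReal (mul_nonneg (c_pos hm0).le hJ0)]

/-- A Brownian motion agrees almost surely, at all times simultaneously, with a pre-Brownian
motion all of whose paths are continuous and started at `0`. -/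
lemma exists_continuous_version (hB : IsBrownianReal B P) :
    ∃ B' : ℝ≥0 → Ω → ℝ, IsPreBrownianReal B' P ∧ (∀ t, Measurable (B' t)) ∧
      (∀ ω, Continuous (B' · ω)) ∧ (∀ ω, B' 0 ω = 0) ∧ ∀ᵐ ω ∂P, ∀ t, B' t ω = B t ω := by
  classical
  let q := TopologicalSpace.denseSeq ℝ≥0
  have hgood : ∀ᵐ ω ∂P, Continuous (B · ω) ∧ B 0 ω = 0 ∧
      ∀ n, B (q n) ω = (hB.aemeasurable (q n)).mk (B (q n)) ω := by
    filter_upwards [hB.cont, hB.eval_zero_ae_eq_zero,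
      ae_all_iff.2 fun n ↦ (hB.aemeasurable (q n)).ae_eq_mk] with ω h1 h2 h3 using ⟨h1, h2, h3⟩
  obtain ⟨N, hN, hNm, hN0⟩ := exists_measurable_superset_of_null (ae_iff.1 hgood)
  have hNgood : ∀ ω ∉ N, Continuous (B · ω) ∧ B 0 ω = 0 ∧
      ∀ n, B (q n) ω = (hB.aemeasurable (q n)).mk (B (q n)) ω := fun ω hω ↦ by
    by_contra h
    exact hω (hN h)
  have hNae : ∀ᵐ ω ∂P, ω ∉ N := measure_eq_zero_iff_ae_notMem.1 hN0
  -- The path is set to zero on a measurable null set containing all bad `ω`. Off it, `B` agrees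
  -- with measurable representatives at a dense sequence of times, and continuity extends
  -- measurability to every time.
  let B' : ℝ≥0 → Ω → ℝ := fun t ↦ Nᶜ.indicator (B t)
  have hmem : ∀ ω ∈ N, ∀ t, B' t ω = 0 := fun ω hω t ↦
    indicator_of_notMem (notMem_compl_iff.2 hω) _
  have hnmem : ∀ ω ∉ N, ∀ t, B' t ω = B t ω := fun ω hω t ↦ indicator_of_mem hω _
  have hae : ∀ᵐ ω ∂P, ∀ t, B' t ω = B t ω := hNae.mono hnmem
  have hcont : ∀ ω, Continuous (B' · ω) := fun ω ↦ by
    by_cases hω : ω ∈ N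
    · simp only [hmem ω hω]
      exact continuous_const
    · simp only [hnmem ω hω]
      exact (hNgood ω hω).1
  have hq : ∀ n, Measurable (B' (q n)) := fun n ↦ by
    have : B' (q n) = Nᶜ.indicator ((hB.aemeasurable (q n)).mk (B (q n))) := by
      ext ω
      by_cases hω : ω ∈ N
      · rw [hmem ω hω, indicator_of_notMem (notMem_compl_iff.2 hω)]
      · rw [hnmem ω hω, indicator_of_mem (by exact hω), (hNgood ω hω).2.2 n]
    rw [this]
    exact (hB.aemeasurable (q n)).measurable_mk.indicator hNm.compl
  refine ⟨B', hB.toIsPreBrownianReal.congr fun t ↦ ?_, fun t ↦ ?_, hcont, fun ω ↦ ?_, hae⟩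
  · filter_upwards [hae] with ω hω using (hω t).symm
  · obtain ⟨x, hx, hxt⟩ := mem_closure_iff_seq_limit.1
      (TopologicalSpace.denseRange_denseSeq ℝ≥0 t)
    refine measurable_of_tendsto_metrizable (f := fun n ↦ B' (x n)) (fun n ↦ ?_)
      (tendsto_pi_nhds.2 fun ω ↦ ((hcont ω).tendsto t).comp hxt)
    obtain ⟨k, hk⟩ := hx n
    rw [← hk]
    exact hq k
  · by_cases hω : ω ∈ N
    · exact hmem ω hω 0
    · rw [hnmem ω hω, (hNgood ω hω).2.1]

lemma phi_nonneg {m : ℝ} : 0 ≤ phi m :=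
  intervalIntegral.integral_nonneg two_pos.le fun _ hy ↦
    div_nonneg (Real.rpow_nonneg hy.1 _) (by linarith [hy.1])

/-- Integrability and expectations of the positive, negative and signed functionals. -/
lemma integral_functionals (hB : IsBrownianReal B P) {m : ℝ} (hm : 0 ≤ m) :
    (Integrable (Apos B m) P ∧ ∫ ω, Apos B m ω ∂P = c m / (2 : ℝ) ^ (m + 1) * phi m) ∧
    (Integrable (Aneg B m) P ∧ ∫ ω, Aneg B m ω ∂P = c m / (2 : ℝ) ^ (m + 1) * Real.log 3) ∧
    A B m =ᵐ[P] fun ω ↦ Apos B m ω - Aneg B m ω := by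
  obtain ⟨B', hB', hm', hc', h0', hae⟩ := exists_continuous_version hB
  have hpos := integral_scaled_functional hB' hm' hc' h0'
    (g := fun x ↦ pow₀ (max x 0) m) ((measurable_pow₀ m).comp (measurable_id.max measurable_const))
    (fun x ↦ pow₀_nonneg (le_max_right _ _) m) (bounded_pow₀_pos hm) hm
    (div_nonneg phi_nonneg (by positivity)) (lintegral_pos_part hm)
  have hneg := integral_scaled_functional hB' hm' hc' h0'
    (g := fun x ↦ pow₀ (max (-x) 0) m)
    ((measurable_pow₀ m).comp (measurable_neg.max measurable_const))
    (fun x ↦ pow₀_nonneg (le_max_right _ _) m) (bounded_pow₀_neg hm) hm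
    (div_nonneg (Real.log_nonneg (by norm_num)) (by positivity)) (lintegral_neg_part hm)
  have epos : (fun ω ↦ 1 / T₁ B' ω ^ (1 + m / 2) *
      ∫ s in (0 : ℝ)..T₁ B' ω, pow₀ (max (B' s.toNNReal ω) 0) m) =ᵐ[P] Apos B m := by
    filter_upwards [hae] with ω hω
    simp only [Apos, T₁_congr hω, hω]
  have eneg : (fun ω ↦ 1 / T₁ B' ω ^ (1 + m / 2) *
      ∫ s in (0 : ℝ)..T₁ B' ω, pow₀ (max (-B' s.toNNReal ω) 0) m) =ᵐ[P] Aneg B m := by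
    filter_upwards [hae] with ω hω
    simp only [Aneg, T₁_congr hω, hω]
  refine ⟨⟨hpos.1.congr epos, ?_⟩, ⟨hneg.1.congr eneg, ?_⟩, ?_⟩
  · rw [← integral_congr_ae epos, hpos.2]; ring
  · rw [← integral_congr_ae eneg, hneg.2]; ring
  · filter_upwards [hB.cont] with ω hω using A_eq_sub hω hm

/-- With `log 3` rewritten as `phi 1`, the sign is read off from the monotonicity of `phi`. -/
lemma integral_A (hB : IsBrownianReal B P) {m : ℝ} (hm : 0 ≤ m) :
    ∫ ω, A B m ω ∂P = c m / (2 : ℝ) ^ (m + 1) * (phi m - phi 1) := by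
  obtain ⟨hpos, hneg, hA⟩ := integral_functionals hB hm
  rw [integral_congr_ae hA, integral_sub hpos.1 hneg.1, hpos.2, hneg.2, phi_one]
  ring

end

end BrownianHit

theorem theorem2 {Ω : Type*} [MeasurableSpace Ω] (P : Measure Ω) [IsProbabilityMeasure P]
    (B : ℝ≥0 → Ω → ℝ) (hB : IsBrownianReal B P) :
    -- the hitting time is almost surely finite and positive
    (∀ᵐ ω ∂P, BrownianHit.hit B ω ≠ ⊤ ∧ 0 < BrownianHit.T₁ B ω) ∧
    -- the expectations, with the closed forms of the Gaussian moments
    (∀ m : ℝ, 0 ≤ m →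
      (BrownianHit.c m = Real.Gamma (1 + m) / ((2 : ℝ) ^ (m / 2) * Real.Gamma (1 + m / 2)) ∧
        BrownianHit.c m = 1 / √Real.pi * (2 : ℝ) ^ (m / 2) * Real.Gamma ((1 + m) / 2)) ∧
      (Integrable (BrownianHit.Apos B m) P ∧
        ∫ ω, BrownianHit.Apos B m ω ∂P
          = BrownianHit.c m / (2 : ℝ) ^ (m + 1) * BrownianHit.phi m) ∧
      (Integrable (BrownianHit.Aneg B m) P ∧
        ∫ ω, BrownianHit.Aneg B m ω ∂P
          = BrownianHit.c m / (2 : ℝ) ^ (m + 1) * Real.log 3) ∧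
      (Integrable (BrownianHit.A B m) P ∧
        ∫ ω, BrownianHit.A B m ω ∂P
          = ∫ ω, BrownianHit.Apos B m ω ∂P - ∫ ω, BrownianHit.Aneg B m ω ∂P)) ∧
    -- convexity of `φ`, positivity of `φ'(0)` and monotonicity
    ConvexOn ℝ (Ioi (-2)) BrownianHit.phi ∧
    (∃ d : ℝ, 0 < d ∧ d = ∫ y in (0 : ℝ)..2, y * Real.log y / (1 + y) ∧
      HasDerivAt BrownianHit.phi d 0) ∧
    StrictMonoOn BrownianHit.phi (Ici 0) ∧
    -- the sign of the expectation of the signed functional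
    (∀ m : ℝ, 1 < m → 0 < ∫ ω, BrownianHit.A B m ω ∂P) ∧
    (∀ m : ℝ, 0 ≤ m → m < 1 → ∫ ω, BrownianHit.A B m ω ∂P < 0) ∧
    ∫ ω, BrownianHit.A B 1 ω ∂P = 0 := by
  have hcoef : ∀ m : ℝ, 0 ≤ m → 0 < BrownianHit.c m / (2 : ℝ) ^ (m + 1) := fun m hm ↦
    div_pos (BrownianHit.c_pos hm) (by positivity)
  refine ⟨?_, fun m hm ↦ ⟨⟨BrownianHit.c_eq_gamma_div hm, BrownianHit.c_eq_gamma_half hm⟩, ?_⟩,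
    BrownianHit.convexOn_phi, ⟨_, BrownianHit.deriv_phi_zero_pos, rfl,
    BrownianHit.hasDerivAt_phi_zero⟩, BrownianHit.strictMonoOn_phi, fun m hm ↦ ?_,
    fun m hm hm1 ↦ ?_, ?_⟩
  · obtain ⟨B', hB', hm', hc', h0', hae⟩ := BrownianHit.exists_continuous_version hB
    filter_upwards [hae, BrownianHit.ae_T₁_spec hB' hm' hc' h0'] with ω hω hT
    rw [← BrownianHit.hit_congr hω, ← BrownianHit.T₁_congr hω]
    exact ⟨hT.1, hT.2.1⟩
  · obtain ⟨hpos, hneg, hA⟩ := BrownianHit.integral_functionals hB hm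
    refine ⟨hpos, hneg, (hpos.1.sub hneg.1).congr hA.symm, ?_⟩
    rw [integral_congr_ae hA, integral_sub hpos.1 hneg.1]
  · have hm0 : 0 ≤ m := by linarith
    rw [BrownianHit.integral_A hB hm0]
    exact mul_pos (hcoef m hm0) (sub_pos.2 (BrownianHit.strictMonoOn_phi (mem_Ici.2 zero_le_one) hm0 hm))
  · rw [BrownianHit.integral_A hB hm]
    exact mul_neg_of_pos_of_neg (hcoef m hm)
      (sub_neg.2 (BrownianHit.strictMonoOn_phi hm (mem_Ici.2 zero_le_one) hm1))
  · rw [BrownianHit.integral_A hB zero_le_one, sub_self, mul_zero]
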